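/- Let $\lambda_0<\lambda_1<\lambda_2<\cdots$ be real numbers and let $a_0,a_1,a_2,\dots$ be complex numbers that are not all zero (in particular, these may be the exponents and coefficients of a general Dirichlet series, where $\lambda_n\to\infty$). Let $n_0$ be the first index with $a_{n_0}\neq 0$, let $n'$ be any index with $a_{n'}\neq 0$, and consider the section $$f_{n'}(z)=\sum_{k=0}^{n'} a_k e^{-\lambda_k z}.$$ (1) Let $h(\theta)=\max(-\lambda_{n_0}\cos\theta,\,-\lambda_{n'}\cos\theta)$ for $\theta\in\mathbb R$; that is, for $\theta\in[0,2\pi]$, $h(\theta)=-\lambda_{n'}\cos\theta$ if $\frac{\pi}{2}\le\theta\le\frac{3\pi}{2}$ and $h(\theta)=-\lambda_{n_0}\cos\theta$ otherwise. Then $h$ is the indicator function of $f_{n'}$ with respect to the order $1$: there is a measurable set $E_0\subset\mathbb R$ with $|E_0\cap[0,r]|/r\to0$ as $r\to\infty$ such that $$\lim_{r\to\infty,\ r\notin E_0}\frac{\log|f_{n'}(re^{i\theta})|}{r}=h(\theta)\qquad\text{uniformly in }\theta .$$ Unless $f_{n'}$ is constant (which happens only if $n'=n_0$ and $\lambda_{n_0}=0$),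 $f_{n'}$ is an entire function of order $1$ and normal type, hence of completely regular growth. (2) For $\alpha<\beta$ let $N_f(r;\alpha,\beta)$ denote the number of zeros of $f$, counted with multiplicity, in the finite sector $0<|z|<r$, $\alpha<\arg z<\beta$. For each $\theta\in\mathbb R$ and all sufficiently small $\delta>0$ (depending on $\theta$), $$\lim_{r\to\infty}\frac{N_{f_{n'}}(r;\theta-\delta,\theta+\delta)}{r}=\begin{cases}\dfrac{\lambda_{n'}-\lambda_{n_0}}{2\pi}&\text{if }\theta\in\pi(\mathbb Z+\frac12),\\[2mm]0&\text{otherwise.}\end{cases}$$ (3) For each $n\ge1$, the section $f_n(s)=\sum_{k=1}^n k^{-s}$ of the Riemann zeta function satisfies, for each $\theta\in\mathbb R$ and all sufficiently small $\delta>0$, $$\lim_{r\to\infty}\frac{N_{f_n}(r;\theta-\delta,\theta+\delta)}{r}=\begin{cases}\dfrac{\log n}{2\pi}&\text{if }\theta\in\pi(\mathbb Z+\frac12),\\[2mm]0&\text{otherwise.}\end{cases}$$ -/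

import Mathlib

open Filter Topology

noncomputable section

namespace DirichletSections

/-- The section `f_n(z) = ∑_{k=0}^n a_k e^{-λ_k z}` of a general Dirichlet series. -/
def dirichletSection (a : ℕ → ℂ) (lam : ℕ → ℝ) (n : ℕ) (z : ℂ) : ℂ :=
  ∑ k ∈ Finset.range (n + 1), a k * Complex.exp (-(lam k : ℂ) * z)

/-- The section `∑_{k=1}^n k^{-s}` of the Riemann zeta function. -/
def zetaSection (n : ℕ) (s : ℂ) : ℂ :=
  ∑ k ∈ Finset.Icc 1 n, (k : ℂ) ^ (-s)

/-- The order of an entire function `f`: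
the infimum of all `ρ ≥ 0` such that `f(z) = O(exp(|z|^ρ))` as `z → ∞`. -/
def entireOrder (f : ℂ → ℂ) : ENNReal :=
  ⨅ (ρ : NNReal) (_ : f =O[cocompact ℂ] fun z => Real.exp (‖z‖ ^ (ρ : ℝ))), (ρ : ENNReal)

/-- The type of an entire function `f` with respect to the order `σ`:
the infimum of all `A ≥ 0` such that `f(z) = O(exp(A |z|^σ))` as `z → ∞`. -/
def entireType (f : ℂ → ℂ) (σ : ℝ) : ENNReal :=
  ⨅ (A : NNReal) (_ : f =O[cocompact ℂ] fun z => Real.exp ((A : ℝ) * ‖z‖ ^ σ)), (A : ENNReal)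

/-- A set of radii of relative linear density (relative measure) zero. -/
def HasRelativeDensityZero (E : Set ℝ) : Prop :=
  MeasurableSet E ∧
    Tendsto (fun r : ℝ => (MeasureTheory.volume (E ∩ Set.Icc 0 r)).toReal / r) atTop (𝓝 0)

/-- `h(θ) = lim log|f(r e^{iθ})| / r^σ`, uniformly in `θ`, as `r → ∞` outside some exceptional set
of relative linear density zero. As `log 0` is to be read as `-∞`, the function
must not vanish at the points where the estimate is required. -/
def HasIndicator (f : ℂ → ℂ) (σ : ℝ) (h : ℝ → ℝ) : Prop :=
  ∃ E : Set ℝ, HasRelativeDensityZero E ∧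
    ∀ ε > 0, ∃ R > 0, ∀ r > R, r ∉ E → ∀ θ : ℝ,
      f (r * Complex.exp (θ * Complex.I)) ≠ 0 ∧
        |Real.log ‖f (r * Complex.exp (θ * Complex.I))‖ / r ^ σ - h θ| < ε

/-- `f` is an entire function of completely regular growth, of order `σ` and normal type,
with indicator function `h`. -/
structure HasCompletelyRegularGrowth (f : ℂ → ℂ) (σ : ℝ) (h : ℝ → ℝ) : Prop where
  differentiable : Differentiable ℂ f
  order_pos : 0 < σ
  order_eq : entireOrder f = ENNReal.ofReal σ
  type_pos : 0 < entireType f σ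
  type_lt_top : entireType f σ < ⊤
  indicator : HasIndicator f σ h

/-- The finite open sector `0 < |z| < r`, `α < arg z < β` (for some value of the argument). -/
def sector (r α β : ℝ) : Set ℂ :=
  {z | ∃ ρ φ : ℝ, 0 < ρ ∧ ρ < r ∧ α < φ ∧ φ < β ∧ z = ρ * Complex.exp (φ * Complex.I)}

/-- `N_f(r; α, β)`: the number of zeros of `f`, counted with multiplicity, in the finite sector.
(The order of vanishing is `0` at points that are not zeros.) -/
def zeroCount (f : ℂ → ℂ) (r α β : ℝ) : ℕ :=
  ∑ᶠ z ∈ sector r α β, analyticOrderNatAt f z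

/-- For all small enough `δ > 0`, the zeros of `f` in the sector `θ - δ < arg z < θ + δ`
have linear density `d`; in particular, each finite sector holds only finitely many zeros. -/
def HasSmallSectorDensity (f : ℂ → ℂ) (θ d : ℝ) : Prop :=
  ∃ δ₀ > 0, ∀ δ : ℝ, 0 < δ → δ < δ₀ →
    (∀ r : ℝ, (sector r (θ - δ) (θ + δ) ∩ {z | f z = 0}).Finite) ∧
    Tendsto (fun r : ℝ => (zeroCount f r (θ - δ) (θ + δ) : ℝ) / r) atTop (𝓝 d)

end DirichletSections

end

/-! On a vertical line far to the right the term of smallest exponent dominates the sum, far to the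
left the term of largest exponent. Hence `|f|` is at most a constant times `exp (domExp l₀ l₁ (Re
z))` everywhere, and is comparable to it outside a strip `|Re z| < X`. These bounds (`ExpBounds`)
are all that is used about the section; in particular its zeros lie in the strip.

Both bounds depend on `Re z` alone, so estimates in discs of fixed size are uniform under vertical
translation. Dividing out the zeros in such a disc and applying Harnack's inequality to the cofactor
gives `|f w| ≥ κ d ^ K` at distance `d` from the zeros (`exists_local_bound`), hence `log |f z| =
domExp l₀ l₁ (Re z) + O(1 + log (1 / d))` (`exists_log_bound`). Circles avoiding the moduli of the
zeros by `1 / (1 + r)` give an error `O(log r)`; the excluded radii have density zero because each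
ring of unit width contains boundedly many zeros. This is the indicator.

For the zeros, the mean of `domExp` over a circle of radius `R` is `R (l₁ - l₀) / π + O(1)`.
Jensen's formula at the radii `R / (1 + τ)`, `R`, `(1 + τ) R` then counts the zeros in a disc,
uniformly over centres on `Re z = X`. Within the strip, a sector of radius `r` about the direction
`±i` is nearly the disc of radius `r / 2` about `X ± i r / 2`; moving the centre thus separates the
upper zeros from the lower ones. Sectors about other directions meet the strip in a bounded set. -/

namespace DirichletSections

/-! ### Lower bounds for entire functions away from their zeros -/

/-- Harnack's inequality for the logarithm of a bounded function without zeros. -/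
lemma log_sub_log_norm_le {g : ℂ → ℂ} {c w : ℂ} {ρ M : ℝ} (hρ : 0 < ρ) (hg : Differentiable ℂ g)
    (hne : ∀ z ∈ Metric.closedBall c ρ, g z ≠ 0) (hM : ∀ z ∈ Metric.closedBall c ρ, ‖g z‖ ≤ M)
    (hw : w ∈ Metric.closedBall c (ρ / 2)) :
    Real.log M - Real.log ‖g w‖ ≤ 3 * (Real.log M - Real.log ‖g c‖) := by
  set v : ℂ → ℝ := fun z => Real.log M - Real.log ‖g z‖ with hv
  have hharm : InnerProductSpace.HarmonicOnNhd v (Metric.closedBall c ρ) := by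
    intro z hz
    have h1 : InnerProductSpace.HarmonicAt (fun z => Real.log ‖g z‖) z :=
      (hg.analyticAt z).harmonicAt_log_norm (hne z hz)
    have h2 : InnerProductSpace.HarmonicAt (fun _ : ℂ => Real.log M) z :=
      InnerProductSpace.harmonicAt_const _
    exact h2.sub h1
  have hv0 : ∀ z ∈ Metric.closedBall c ρ, 0 ≤ v z := fun z hz =>
    sub_nonneg.2 (Real.log_le_log (norm_pos_iff.2 (hne z hz)) (hM z hz))
  have hwd : ‖w - c‖ ≤ ρ / 2 := by simpa [dist_eq_norm] using hw
  have hwb : w ∈ Metric.ball c ρ := by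
    rw [Metric.mem_ball, dist_eq_norm]; linarith
  -- Poisson's formula for the nonnegative harmonic function `v`. For `|w - c| ≤ ρ / 2` the kernel
  -- is at most `(ρ + ρ / 2) / (ρ - ρ / 2) = 3`.
  have hP := hharm.circleAverage_re_herglotzRieszKernel_smul hwb
  have hC : Real.circleAverage v c ρ = v c := by
    refine InnerProductSpace.HarmonicOnNhd.circleAverage_eq ?_
    rwa [abs_of_pos hρ]
  have hcont : ContinuousOn v (Metric.closedBall c ρ) := fun z hz =>
    (hharm z hz).1.continuousAt.continuousWithinAt
  have hsub : Metric.sphere c |ρ| ⊆ Metric.closedBall c ρ := by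
    rw [abs_of_pos hρ]; exact Metric.sphere_subset_closedBall
  have hint : CircleIntegrable v c ρ :=
    ContinuousOn.circleIntegrable' (hcont.mono hsub)
  have hint3 : CircleIntegrable ((3 : ℝ) • v) c ρ := by
    exact ContinuousOn.circleIntegrable' ((hcont.mono hsub).const_smul 3)
  have hintP : CircleIntegrable ((Complex.re ∘ herglotzRieszKernel c w) • v) c ρ := by
    refine ContinuousOn.circleIntegrable' ?_
    refine ContinuousOn.smul ?_ (hcont.mono hsub)
    exact Complex.continuous_re.comp_continuousOn (continuousOn_herglotzRieszKernel_sphere hwb)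
  change v w ≤ 3 * v c
  rw [← hP, ← hC, ← smul_eq_mul, ← Real.circleAverage_smul]
  refine Real.circleAverage_mono hintP hint3 fun z hz => ?_
  have hz' : z ∈ Metric.sphere c ρ := by rwa [abs_of_pos hρ] at hz
  have hk := re_herglotzRieszKernel_le hz' hwb
  have hk3 : (ρ + ‖w - c‖) / (ρ - ‖w - c‖) ≤ 3 := by
    rw [div_le_iff₀ (by linarith)]; linarith
  simp only [Pi.smul_apply', Function.comp, herglotzRieszKernel_def, smul_eq_mul, Pi.smul_apply]
  exact mul_le_mul_of_nonneg_right (hk.trans hk3) (hv0 z (hsub hz))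

lemma pow_le_norm_prod_sub {w : ℂ} {d : ℝ} (hd : 0 ≤ d) (s : Multiset ℂ)
    (hs : ∀ u ∈ s, d ≤ ‖w - u‖) :
    d ^ s.card ≤ ‖(s.map (fun u => w - u)).prod‖ := by
  induction s using Multiset.induction_on with
  | empty => simp
  | cons a s ih =>
    have h1 := ih (fun u hu => hs u (Multiset.mem_cons_of_mem hu))
    have h2 := hs a (Multiset.mem_cons_self a s)
    rw [Multiset.map_cons, Multiset.prod_cons, norm_mul, Multiset.card_cons, pow_succ, mul_comm]
    exact mul_le_mul h2 h1 (pow_nonneg hd _) (norm_nonneg _)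

/-- A bound for the cofactor when zeros in a small disc are divided out. -/
lemma norm_cofactor_le {f g : ℂ → ℂ} {c : ℂ} {ρ M : ℝ} (hρ : 0 < ρ) (hg : Differentiable ℂ g)
    (hM : ∀ z ∈ Metric.closedBall c (3 * ρ), ‖f z‖ ≤ M) (s : Multiset ℂ)
    (hs : ∀ u ∈ s, u ∈ Metric.closedBall c ρ)
    (hfg : ∀ z, f z = (s.map (fun u => z - u)).prod * g z) :
    ∀ z ∈ Metric.closedBall c (3 * ρ), ‖g z‖ ≤ M / (2 * ρ) ^ s.card := by
  intro z hz
  have h3 : 3 * ρ ≠ 0 := by positivity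
  -- By the maximum principle only the circle of radius `3 * ρ` matters, and there each factor `|w -
  -- u|` is at least `2 * ρ`.
  refine Complex.norm_le_of_forall_mem_frontier_norm_le (U := Metric.ball c (3 * ρ))
    Metric.isBounded_ball hg.diffContOnCl (fun w hw => ?_) (by rwa [closure_ball _ h3])
  rw [frontier_ball _ h3] at hw
  have hprod : (2 * ρ) ^ s.card ≤ ‖(s.map (fun u => w - u)).prod‖ := by
    refine pow_le_norm_prod_sub (by positivity) s fun a ha => ?_
    have ha := hs a ha
    rw [Metric.mem_closedBall, dist_comm] at ha
    rw [Metric.mem_sphere] at hw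
    rw [← dist_eq_norm]
    have := dist_triangle w a c
    rw [dist_comm a c] at this
    linarith
  have hMw := hM w (Metric.sphere_subset_closedBall hw)
  rw [hfg, norm_mul] at hMw
  rw [le_div_iff₀ (by positivity), mul_comm]
  exact (mul_le_mul_of_nonneg_right hprod (norm_nonneg _)).trans hMw

lemma norm_prod_sub_le {w : ℂ} {ρ : ℝ} (s : Multiset ℂ) (hs : ∀ u ∈ s, ‖w - u‖ ≤ ρ) :
    ‖(s.map (fun u => w - u)).prod‖ ≤ ρ ^ s.card := by
  induction s using Multiset.induction_on with
  | empty => simp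
  | cons a s ih =>
    have h1 := ih (fun u hu => hs u (Multiset.mem_cons_of_mem hu))
    have h2 := hs a (Multiset.mem_cons_self a s)
    rw [Multiset.map_cons, Multiset.prod_cons, norm_mul, Multiset.card_cons, pow_succ, mul_comm]
    exact mul_le_mul h1 h2 (norm_nonneg _) (pow_nonneg ((norm_nonneg _).trans h2) _)

/-- Each zero gains a factor 2: its linear factor is at most `ρ` at the centre but at least `2 * ρ`
on the outer circle. This replaces Jensen's formula as a crude bound on the number of zeros. -/
lemma two_pow_card_le {f g : ℂ → ℂ} {c : ℂ} {ρ M : ℝ} (hρ : 0 < ρ) (hg : Differentiable ℂ g)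
    (hM : ∀ z ∈ Metric.closedBall c (3 * ρ), ‖f z‖ ≤ M) (s : Multiset ℂ)
    (hs : ∀ u ∈ s, u ∈ Metric.closedBall c ρ)
    (hfg : ∀ z, f z = (s.map (fun u => z - u)).prod * g z) :
    2 ^ s.card * ‖f c‖ ≤ M := by
  have h1 := norm_cofactor_le hρ hg hM s hs hfg c (Metric.mem_closedBall_self (by positivity))
  have h2 : ‖(s.map (fun u => c - u)).prod‖ ≤ ρ ^ s.card :=
    norm_prod_sub_le s fun u hu => by
      have := hs u hu
      rwa [Metric.mem_closedBall, dist_comm, dist_eq_norm] at this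
  rw [hfg, norm_mul]
  rw [le_div_iff₀ (by positivity), mul_pow] at h1
  calc 2 ^ s.card * (‖(s.map (fun u => c - u)).prod‖ * ‖g c‖)
      ≤ 2 ^ s.card * (ρ ^ s.card * ‖g c‖) := by gcongr
    _ = ‖g c‖ * (2 ^ s.card * ρ ^ s.card) := by ring
    _ ≤ M := h1

/-- The zeros of an entire function in a disc can be divided out. -/
lemma exists_factorization {f : ℂ → ℂ} {c : ℂ} {ρ M : ℝ} (hρ : 0 < ρ) (hf : Differentiable ℂ f)
    (hc : f c ≠ 0) (hM : ∀ z ∈ Metric.closedBall c (3 * ρ), ‖f z‖ ≤ M) :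
    ∃ (s : Multiset ℂ) (g : ℂ → ℂ), Differentiable ℂ g ∧ (∀ u ∈ s, u ∈ Metric.closedBall c ρ) ∧
      (∀ z, f z = (s.map (fun u => z - u)).prod * g z) ∧
      ∀ z ∈ Metric.closedBall c ρ, g z ≠ 0 := by
  let P : ℕ → Prop := fun n => ∃ (s : Multiset ℂ) (g : ℂ → ℂ), Differentiable ℂ g ∧
      (∀ u ∈ s, u ∈ Metric.closedBall c ρ) ∧
      (∀ z, f z = (s.map (fun u => z - u)).prod * g z) ∧ s.card = n
  have hP0 : P 0 := ⟨0, f, hf, by simp, by simp, by simp⟩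
  obtain ⟨N, hN⟩ := pow_unbounded_of_one_lt (M / ‖f c‖) (one_lt_two (α := ℝ))
  have hbd : ∀ n, P n → n ≤ N := by
    rintro n ⟨s, g, hg, hs, hfg, rfl⟩
    by_contra! hlt
    have h1 := two_pow_card_le hρ hg hM s hs hfg
    rw [← le_div_iff₀ (norm_pos_iff.2 hc)] at h1
    have h2 : (2 : ℝ) ^ N ≤ 2 ^ s.card := pow_le_pow_right₀ one_le_two hlt.le
    linarith
  -- Divide out as many zeros as possible. A zero of the cofactor left in the disc could be removed
  -- by `dslope`, contradicting maximality.
  obtain ⟨n, hn, hmax⟩ : ∃ n, P n ∧ ∀ m, P m → m ≤ n := by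
    classical
    exact ⟨Nat.findGreatest P N, Nat.findGreatest_spec N.zero_le hP0,
      fun m hm => Nat.le_findGreatest (hbd m hm) hm⟩
  obtain ⟨s, g, hg, hs, hfg, hcard⟩ := hn
  refine ⟨s, g, hg, hs, hfg, fun u hu hgu => ?_⟩
  have hslope : Differentiable ℂ (dslope g u) := by
    rw [← differentiableOn_univ] at hg ⊢
    exact (Complex.differentiableOn_dslope univ_mem).2 hg
  have := hmax (n + 1) ⟨u ::ₘ s, dslope g u, hslope, ?_, ?_, by simp [hcard]⟩
  · omega
  · intro v hv
    rcases Multiset.mem_cons.1 hv with rfl | hv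
    exacts [hu, hs v hv]
  · intro z
    have h1 := sub_smul_dslope g u z
    rw [hgu, sub_zero, smul_eq_mul] at h1
    rw [hfg, Multiset.map_cons, Multiset.prod_cons, ← h1]
    ring

/-- A lower bound for an entire function in terms of the distances to its zeros. -/
lemma exists_zeros_lower_bound {f : ℂ → ℂ} {c : ℂ} {ρ M m : ℝ} (hρ : 0 < ρ)
    (hf : Differentiable ℂ f) (hm : 0 < m) (hc : m ≤ ‖f c‖)
    (hM : ∀ z ∈ Metric.closedBall c (3 * ρ), ‖f z‖ ≤ M) :
    ∃ s : Multiset ℂ, 2 ^ s.card ≤ M / m ∧ (∀ u ∈ s, f u = 0) ∧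
      (∀ z ∈ Metric.closedBall c ρ, f z = 0 → z ∈ s) ∧
      ∀ w ∈ Metric.closedBall c (ρ / 2), ∀ d : ℝ, 0 < d → (∀ u ∈ s, d ≤ ‖w - u‖) →
        M * (m / M) ^ 3 * (d / (2 * ρ)) ^ s.card ≤ ‖f w‖ := by
  have hc0 : f c ≠ 0 := norm_pos_iff.1 (hm.trans_le hc)
  obtain ⟨s, g, hg, hs, hfg, hne⟩ := exists_factorization hρ hf hc0 hM
  have hcM := two_pow_card_le hρ hg hM s hs hfg
  have hgM := norm_cofactor_le hρ hg hM s hs hfg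
  have hMpos : 0 < M := by
    have := norm_pos_iff.2 hc0
    exact lt_of_lt_of_le (by positivity) hcM
  have hz : ∀ z, z ∈ s → f z = 0 := fun z hz => by
    rw [hfg, Multiset.prod_eq_zero (Multiset.mem_map.2 ⟨z, hz, sub_self z⟩), zero_mul]
  refine ⟨s, ?_, hz, fun z hzb hfz => ?_, fun w hw d hd hdu => ?_⟩
  · rw [le_div_iff₀ hm]
    exact (mul_le_mul_of_nonneg_left hc (by positivity)).trans hcM
  · rw [hfg] at hfz
    have h1 := (mul_eq_zero.1 hfz).resolve_right (hne z hzb)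
    obtain ⟨u, hu, huz⟩ := Multiset.mem_map.1 (Multiset.prod_eq_zero_iff.1 h1)
    rwa [sub_eq_zero.1 huz]
  · have hsub : Metric.closedBall c ρ ⊆ Metric.closedBall c (3 * ρ) :=
      Metric.closedBall_subset_closedBall (by linarith)
    have hwρ : w ∈ Metric.closedBall c ρ := Metric.closedBall_subset_closedBall (by linarith) hw
    have hcρ : c ∈ Metric.closedBall c ρ := Metric.mem_closedBall_self hρ.le
    have hH := log_sub_log_norm_le hρ hg hne (fun z hz => hgM z (hsub hz)) hw
    set A := M / (2 * ρ) ^ s.card with hA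
    have hApos : 0 < A := by positivity
    have hgw : 0 < ‖g w‖ := norm_pos_iff.2 (hne w hwρ)
    have hgc : 0 < ‖g c‖ := norm_pos_iff.2 (hne c hcρ)
    -- At the centre the cofactor falls short of its upper bound `A` by at most the factor `m / M`;
    -- Harnack's constant 3 turns this into `(m / M) ^ 3` at `w`.
    have hgcA : m / M * A ≤ ‖g c‖ := by
      have h2 : ‖(s.map (fun u => c - u)).prod‖ ≤ ρ ^ s.card :=
        norm_prod_sub_le s fun u hu => by
          have := hs u hu
          rwa [Metric.mem_closedBall, dist_comm, dist_eq_norm] at this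
      have h3 : m ≤ ρ ^ s.card * ‖g c‖ := by
        refine hc.trans ?_
        rw [hfg, norm_mul]
        gcongr
      have h4 : ρ ^ s.card * ‖g c‖ ≤ (2 * ρ) ^ s.card * ‖g c‖ := by
        gcongr
        linarith
      have h5 : m / M * A = m / (2 * ρ) ^ s.card := by
        rw [hA]; field_simp
      rw [h5, div_le_iff₀ (by positivity)]
      linarith
    have hlog : Real.log A + 3 * Real.log (m / M) ≤ Real.log ‖g w‖ := by
      have h6 := Real.log_le_log (by positivity) hgcA
      rw [Real.log_mul (by positivity) hApos.ne'] at h6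
      linarith
    have hgw' : A * (m / M) ^ 3 ≤ ‖g w‖ := by
      rw [← Real.log_le_log_iff (by positivity) hgw, Real.log_mul hApos.ne' (by positivity),
        Real.log_pow]
      exact_mod_cast hlog
    have hprod := pow_le_norm_prod_sub hd.le s hdu
    rw [hfg, norm_mul]
    calc M * (m / M) ^ 3 * (d / (2 * ρ)) ^ s.card = d ^ s.card * (A * (m / M) ^ 3) := by
          rw [hA, div_pow d]
          generalize (2 * ρ) ^ s.card = B
          ring
      _ ≤ _ := by gcongr

/-! ### Functions with exponential bounds outside a strip -/

/-- The exponent `max (-l₀ x) (-l₁ x)` of the dominating exponential on the line `Re z = x`. -/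
noncomputable def domExp (l₀ l₁ x : ℝ) : ℝ := max (-l₀ * x) (-l₁ * x)

lemma abs_domExp_sub_le (l₀ l₁ x y : ℝ) :
    |domExp l₀ l₁ x - domExp l₀ l₁ y| ≤ (|l₀| + |l₁|) * |x - y| := by
  refine (abs_max_sub_max_le_max _ _ _ _).trans (max_le ?_ ?_)
  · rw [← mul_sub, abs_mul, abs_neg]
    gcongr
    linarith [abs_nonneg l₁]
  · rw [← mul_sub, abs_mul, abs_neg]
    gcongr
    linarith [abs_nonneg l₀]

lemma abs_domExp_le (l₀ l₁ x : ℝ) : |domExp l₀ l₁ x| ≤ (|l₀| + |l₁|) * |x| := by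
  simpa [domExp] using abs_domExp_sub_le l₀ l₁ x 0

/-- An entire function whose modulus is at most `exp (domExp l₀ l₁ (Re z))` up to a constant
factor everywhere, and comparable to it outside the vertical strip `|Re z| < X`. -/
structure ExpBounds (f : ℂ → ℂ) (l₀ l₁ X C : ℝ) : Prop where
  differentiable : Differentiable ℂ f
  le : l₀ ≤ l₁
  X_pos : 0 < X
  C_nonneg : 0 ≤ C
  upper : ∀ z, ‖f z‖ ≤ Real.exp (domExp l₀ l₁ z.re + C)
  lower : ∀ z : ℂ, X ≤ |z.re| → Real.exp (domExp l₀ l₁ z.re - C) ≤ ‖f z‖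

namespace ExpBounds

variable {f : ℂ → ℂ} {l₀ l₁ X C : ℝ}

lemma ne_zero (hf : ExpBounds f l₀ l₁ X C) {z : ℂ} (hz : X ≤ |z.re|) : f z ≠ 0 :=
  norm_pos_iff.1 ((Real.exp_pos _).trans_le (hf.lower z hz))

lemma abs_re_lt (hf : ExpBounds f l₀ l₁ X C) {u : ℂ} (hu : f u = 0) : |u.re| < X := by
  by_contra! h
  exact hf.ne_zero h hu

/-- A lower bound in terms of the distance to the zeros, uniform under vertical translations. -/
lemma exists_local_bound (hf : ExpBounds f l₀ l₁ X C) (ρ : ℝ) :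
    ∃ K : ℕ, ∃ κ > 0, ∀ T : ℝ, ∃ s : Finset ℂ, s.card ≤ K ∧
      (∀ z ∈ Metric.closedBall (T * Complex.I) ρ, f z = 0 → z ∈ s) ∧
      ∀ w ∈ Metric.closedBall (T * Complex.I) ρ, ∀ d : ℝ, 0 < d → d ≤ 1 →
        (∀ u, f u = 0 → d ≤ ‖w - u‖) → κ * d ^ K ≤ ‖f w‖ := by
  classical
  have hX := hf.X_pos
  set L := |l₀| + |l₁| with hL
  have hL0 : 0 ≤ L := by positivity
  -- The centre must have real part `X` for the lower bound to apply, so the disc about `T * I` is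
  -- enlarged: `ρ + X ≤ r / 2`. Neither `M` nor `m` depends on `T`.
  set r := 2 * (|ρ| + X) + 1 with hr
  have hr1 : 1 ≤ r := by
    have := abs_nonneg ρ
    linarith
  set M := Real.exp (L * (X + 3 * r) + C) with hM
  set m := Real.exp (-(L * X) - C) with hm
  have hMp : 0 < M := Real.exp_pos _
  have hmp : 0 < m := Real.exp_pos _
  obtain ⟨K, hK⟩ := pow_unbounded_of_one_lt (M / m) (one_lt_two (α := ℝ))
  refine ⟨K, M * (m / M) ^ 3 * (1 / (2 * r)) ^ K, by positivity, fun T => ?_⟩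
  set c : ℂ := X + T * Complex.I with hc
  have hcre : c.re = X := by simp [hc]
  have hfc : m ≤ ‖f c‖ := by
    refine le_trans ?_ (hf.lower c (by rw [hcre]; exact le_abs_self X))
    rw [hcre]
    refine Real.exp_le_exp.2 ?_
    have := (abs_le.1 (abs_domExp_le l₀ l₁ X)).1
    rw [abs_of_pos hX] at this
    linarith
  have hfM : ∀ z ∈ Metric.closedBall c (3 * r), ‖f z‖ ≤ M := fun z hz => by
    refine (hf.upper z).trans (Real.exp_le_exp.2 ?_)
    have h1 := (abs_le.1 (abs_domExp_le l₀ l₁ z.re)).2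
    have h2 : |z.re| ≤ X + 3 * r := by
      have h3 : |(z - c).re| ≤ 3 * r :=
        (Complex.abs_re_le_norm _).trans (by simpa [dist_eq_norm] using hz)
      rw [Complex.sub_re, hcre] at h3
      rw [abs_le] at h3 ⊢
      constructor <;> linarith
    have h4 : L * |z.re| ≤ L * (X + 3 * r) := mul_le_mul_of_nonneg_left h2 hL0
    linarith
  obtain ⟨s, hcard, hs0, hsz, hsl⟩ :=
    exists_zeros_lower_bound (by linarith : 0 < r) hf.differentiable hmp hfc hfM
  have hcardK : s.card ≤ K := by
    by_contra! hlt
    have : (2 : ℝ) ^ K ≤ 2 ^ s.card := pow_le_pow_right₀ one_le_two hlt.le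
    linarith
  have hsub : Metric.closedBall (T * Complex.I) ρ ⊆ Metric.closedBall c (r / 2) := by
    refine Metric.closedBall_subset_closedBall' ?_
    have : dist (T * Complex.I) c = X := by
      rw [dist_eq_norm, hc]
      simp [abs_of_pos hX]
    rw [this]
    have := le_abs_self ρ
    linarith
  refine ⟨s.toFinset, (Multiset.toFinset_card_le s).trans hcardK, fun z hz hfz => ?_,
    fun w hw d hd hd1 hdu => ?_⟩
  · exact Multiset.mem_toFinset.2
      (hsz z (Metric.closedBall_subset_closedBall (by linarith) (hsub hz)) hfz)
  · refine le_trans ?_ (hsl w (hsub hw) d hd fun u hu => hdu u (hs0 u hu))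
    rw [mul_assoc, ← mul_pow, one_div_mul_eq_div]
    refine mul_le_mul_of_nonneg_left ?_ (by positivity)
    refine pow_le_pow_of_le_one (by positivity) ?_ hcardK
    rw [div_le_one (by positivity)]
    linarith

/-- The two-sided estimate of `log ‖f z‖` in terms of the distance to the zeros. -/
lemma exists_log_bound (hf : ExpBounds f l₀ l₁ X C) :
    ∃ K : ℕ, ∃ B : ℝ, 0 ≤ B ∧ ∀ z : ℂ, ∀ d : ℝ, 0 < d → d ≤ 1 →
      (∀ u, f u = 0 → d ≤ ‖z - u‖) →
        f z ≠ 0 ∧ |Real.log ‖f z‖ - domExp l₀ l₁ z.re| ≤ B - K * Real.log d := by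
  obtain ⟨K, κ, hκ, h⟩ := hf.exists_local_bound X
  have hX := hf.X_pos
  have hC := hf.C_nonneg
  set L := |l₀| + |l₁| with hL
  have hLX : 0 ≤ L * X := by positivity
  refine ⟨K, C + L * X + |Real.log κ|, by positivity, fun z d hd hd1 hdu => ?_⟩
  have hne : f z ≠ 0 := fun h0 => by
    have := hdu z h0
    simp at this
    linarith
  have hpos := norm_pos_iff.2 hne
  have hlogd : Real.log d ≤ 0 := Real.log_nonpos hd.le hd1
  have hKd : K * Real.log d ≤ 0 := mul_nonpos_of_nonneg_of_nonpos (Nat.cast_nonneg K) hlogd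
  have hup : Real.log ‖f z‖ ≤ domExp l₀ l₁ z.re + C :=
    (Real.log_le_iff_le_exp hpos).2 (hf.upper z)
  refine ⟨hne, abs_le.2 ⟨?_, by linarith [abs_nonneg (Real.log κ)]⟩⟩
  by_cases hz : X ≤ |z.re|
  · have := (Real.le_log_iff_exp_le hpos).2 (hf.lower z hz)
    linarith [abs_nonneg (Real.log κ)]
  -- Inside the strip `domExp` is bounded by `L * X`, so a constant lower bound at the height of `z`
  -- suffices.
  · obtain ⟨s, -, -, hs⟩ := h z.im
    have hmem : z ∈ Metric.closedBall ((z.im : ℂ) * Complex.I) X := by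
      rw [Metric.mem_closedBall, dist_eq_norm]
      have : z - z.im * Complex.I = (z.re : ℂ) := by
        apply Complex.ext <;> simp
      rw [this, Complex.norm_real]
      exact (not_le.1 hz).le
    have h1 := Real.log_le_log (by positivity) (hs z hmem d hd hd1 hdu)
    rw [Real.log_mul hκ.ne' (by positivity), Real.log_pow] at h1
    have h2 := (abs_le.1 (abs_domExp_le l₀ l₁ z.re)).2
    have h3 : L * |z.re| ≤ L * X := by
      gcongr
      exact (not_le.1 hz).le
    linarith [neg_abs_le (Real.log κ)]

/-- The zeros in a ring of bounded width whose centre lies in the strip are bounded in number. -/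
lemma exists_card_ring (hf : ExpBounds f l₀ l₁ X C) :
    ∃ K : ℕ, ∀ c : ℂ, |c.re| ≤ X → ∀ R : ℝ, ∃ s : Finset ℂ, s.card ≤ K ∧
      ∀ u, f u = 0 → |‖u - c‖ - R| ≤ 2 → u ∈ s := by
  classical
  have hX := hf.X_pos
  obtain ⟨K, κ, hκ, h⟩ := hf.exists_local_bound (3 * X + 2)
  refine ⟨K + K, fun c hc R => ?_⟩
  -- A zero in the ring lies in the strip, so `|Im u - Im c|` differs from `R` by at most `2 * X +
  -- 2`: one disc above `c` and one below catch all of them.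
  obtain ⟨s, hs, hsz, -⟩ := h (c.im + R)
  obtain ⟨t, ht, htz, -⟩ := h (c.im - R)
  refine ⟨s ∪ t, (Finset.card_union_le s t).trans (add_le_add hs ht), fun u hu huR => ?_⟩
  have hre := hf.abs_re_lt hu
  have h1 : ‖u - c‖ ≤ |u.re - c.re| + |u.im - c.im| := by
    simpa using Complex.norm_le_abs_re_add_abs_im (u - c)
  have h2 : |u.im - c.im| ≤ ‖u - c‖ := by simpa using Complex.abs_im_le_norm (u - c)
  have h3 : |u.re - c.re| ≤ 2 * X := (abs_sub _ _).trans (by linarith)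
  rw [abs_le] at huR
  have key : ∀ T : ℝ, |u.im - T| ≤ 2 * X + 2 →
      u ∈ Metric.closedBall ((T : ℂ) * Complex.I) (3 * X + 2) := fun T hT => by
    rw [Metric.mem_closedBall, dist_eq_norm]
    refine (Complex.norm_le_abs_re_add_abs_im _).trans ?_
    simp
    linarith
  rw [Finset.mem_union]
  rcases le_total 0 (u.im - c.im) with hs' | hs'
  · left
    refine hsz u (key _ ?_) hu
    rw [abs_of_nonneg hs'] at h1 h2
    rw [abs_le]; constructor <;> linarith
  · right
    refine htz u (key _ ?_) hu
    rw [abs_of_nonpos hs'] at h1 h2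
    rw [abs_le]; constructor <;> linarith

lemma finite_zeros (hf : ExpBounds f l₀ l₁ X C) (R : ℝ) :
    (Metric.closedBall 0 R ∩ {z | f z = 0}).Finite := by
  obtain ⟨K, κ, hκ, h⟩ := hf.exists_local_bound R
  obtain ⟨s, -, hs, -⟩ := h 0
  refine s.finite_toSet.subset fun z hz => hs z ?_ hz.2
  simpa using hz.1

lemma finite_zeros_of_isBounded (hf : ExpBounds f l₀ l₁ X C) {S : Set ℂ}
    (hS : Bornology.IsBounded S) : (S ∩ {z | f z = 0}).Finite := by
  obtain ⟨R, hR⟩ := hS.subset_closedBall 0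
  exact (hf.finite_zeros R).subset (Set.inter_subset_inter_left _ hR)

/-! ### Exceptional radii and the indicator -/

/-- The radii that are too close to the modulus of a zero of `f`. -/
def exceptionalRadii (f : ℂ → ℂ) : Set ℝ :=
  ⋃ u ∈ {u : ℂ | f u = 0}, {r : ℝ | |‖u‖ - r| < 1 / (1 + |r|)}

lemma isOpen_exceptionalRadii (f : ℂ → ℂ) : IsOpen (exceptionalRadii f) := by
  refine isOpen_biUnion fun u _ => isOpen_lt (by fun_prop) ?_
  refine continuous_const.div (by fun_prop) fun r => ?_
  positivity

/-- Only zeros with modulus within 2 of `k` can affect `[k, k + 1]`. They are bounded in number, and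
each removes an interval of length at most `2 / (k + 1)`. -/
lemma exists_volume_exceptionalRadii_le (hf : ExpBounds f l₀ l₁ X C) :
    ∃ K : ℕ, ∀ k : ℕ, MeasureTheory.volume (exceptionalRadii f ∩ Set.Icc (k : ℝ) (k + 1)) ≤
      ENNReal.ofReal (2 * K * (1 / ((k : ℝ) + 1))) := by
  obtain ⟨K, hK⟩ := hf.exists_card_ring
  refine ⟨K, fun k => ?_⟩
  obtain ⟨s, hs, hsz⟩ := hK 0 (by simpa using hf.X_pos.le) k
  have hk : (0 : ℝ) ≤ k := Nat.cast_nonneg k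
  have hsub : exceptionalRadii f ∩ Set.Icc (k : ℝ) (k + 1) ⊆
      ⋃ u ∈ s, Metric.ball ‖u‖ (1 / ((k : ℝ) + 1)) := by
    rintro r ⟨hr, hr1, hr2⟩
    simp only [exceptionalRadii, Set.mem_iUnion, Set.mem_ofPred_eq, exists_prop] at hr ⊢
    obtain ⟨u, hu, hur⟩ := hr
    have hr0 : 0 ≤ r := hk.trans hr1
    rw [abs_of_nonneg hr0] at hur
    have h1 : 1 / (1 + r) ≤ 1 / ((k : ℝ) + 1) :=
      one_div_le_one_div_of_le (by positivity) (by linarith)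
    have h2 : 1 / (1 + r) ≤ 1 := by
      rw [div_le_one (by positivity)]; linarith
    refine ⟨u, hsz u hu ?_, ?_⟩
    · rw [sub_zero]
      rw [abs_lt] at hur
      rw [abs_le]
      constructor <;> linarith
    · rw [Metric.mem_ball, Real.dist_eq, abs_sub_comm]
      linarith
  calc MeasureTheory.volume (exceptionalRadii f ∩ Set.Icc (k : ℝ) (k + 1))
      ≤ MeasureTheory.volume (⋃ u ∈ s, Metric.ball ‖u‖ (1 / ((k : ℝ) + 1))) :=
        MeasureTheory.measure_mono hsub
    _ ≤ ∑ u ∈ s, MeasureTheory.volume (Metric.ball ‖u‖ (1 / ((k : ℝ) + 1))) :=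
        MeasureTheory.measure_biUnion_finset_le _ _
    _ = s.card • ENNReal.ofReal (2 * (1 / ((k : ℝ) + 1))) := by
        simp [Real.volume_ball]
    _ ≤ K • ENNReal.ofReal (2 * (1 / ((k : ℝ) + 1))) := by gcongr
    _ = ENNReal.ofReal (2 * K * (1 / ((k : ℝ) + 1))) := by
        rw [← ENNReal.ofReal_nsmul, nsmul_eq_mul]
        congr 1
        ring

lemma hasRelativeDensityZero_exceptionalRadii (hf : ExpBounds f l₀ l₁ X C) :
    HasRelativeDensityZero (exceptionalRadii f) := by
  refine ⟨(isOpen_exceptionalRadii f).measurableSet, ?_⟩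
  obtain ⟨K, hK⟩ := hf.exists_volume_exceptionalRadii_le
  set v : ℕ → ℝ := fun k => 2 * K * (1 / ((k : ℝ) + 1)) with hv
  have hv0 : ∀ k, 0 ≤ v k := fun k => by positivity
  have hvt : Tendsto v atTop (𝓝 0) := by
    simpa [hv] using (tendsto_one_div_add_atTop_nhds_zero_nat (𝕜 := ℝ)).const_mul (2 * K : ℝ)
  -- The measure up to `r`, divided by `r`, is at most twice a Cesàro mean of the null sequence `v`.
  have hces := hvt.cesaro
  have hn : Tendsto (fun r : ℝ => ⌊r⌋₊ + 1) atTop atTop :=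
    (tendsto_add_atTop_nat 1).comp tendsto_nat_floor_atTop
  have hlim := (hces.comp hn).const_mul 2
  rw [mul_zero] at hlim
  refine tendsto_of_tendsto_of_tendsto_of_le_of_le' tendsto_const_nhds hlim ?_ ?_
  · filter_upwards [eventually_gt_atTop 0] with r hr
    positivity
  · filter_upwards [eventually_ge_atTop 1] with r hr
    have hr0 : 0 < r := by linarith
    set n := ⌊r⌋₊ + 1 with hndef
    have hsub : exceptionalRadii f ∩ Set.Icc 0 r ⊆
        ⋃ k ∈ Finset.range n, exceptionalRadii f ∩ Set.Icc (k : ℝ) (k + 1) := by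
      rintro t ⟨ht, ht0, htr⟩
      simp only [Set.mem_iUnion, exists_prop, Finset.mem_range]
      exact ⟨⌊t⌋₊, Nat.lt_succ_of_le (Nat.floor_mono htr), ht, Nat.floor_le ht0,
        (Nat.lt_floor_add_one t).le⟩
    have hvol : MeasureTheory.volume (exceptionalRadii f ∩ Set.Icc 0 r) ≤
        ENNReal.ofReal (∑ k ∈ Finset.range n, v k) := by
      refine (MeasureTheory.measure_mono hsub).trans
        ((MeasureTheory.measure_biUnion_finset_le _ _).trans ?_)
      rw [ENNReal.ofReal_sum_of_nonneg fun k _ => hv0 k]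
      exact Finset.sum_le_sum fun k _ => hK k
    have hsum0 : 0 ≤ ∑ k ∈ Finset.range n, v k := Finset.sum_nonneg fun k _ => hv0 k
    have hreal : (MeasureTheory.volume (exceptionalRadii f ∩ Set.Icc 0 r)).toReal ≤
        ∑ k ∈ Finset.range n, v k := ENNReal.toReal_le_of_le_ofReal hsum0 hvol
    have hnr : (n : ℝ) ≤ 2 * r := by
      have := Nat.floor_le hr0.le
      rw [hndef]; push_cast; linarith
    have hnpos : (0 : ℝ) < n := by rw [hndef]; positivity
    simp only [Function.comp]
    rw [div_le_iff₀ hr0]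
    refine hreal.trans ?_
    calc ∑ k ∈ Finset.range n, v k = (n : ℝ) * ((n : ℝ)⁻¹ * ∑ k ∈ Finset.range n, v k) := by
          field_simp
      _ ≤ 2 * r * ((n : ℝ)⁻¹ * ∑ k ∈ Finset.range n, v k) := by gcongr
      _ = _ := by ring

lemma tendsto_log_error (B K : ℝ) :
    Tendsto (fun r : ℝ => (B + K * Real.log (1 + r)) / r) atTop (𝓝 0) := by
  have h1 : Tendsto (fun r : ℝ => B / r) atTop (𝓝 0) := tendsto_const_nhds.div_atTop tendsto_id
  have h2 : Tendsto (fun r : ℝ => Real.log (1 + r) / r) atTop (𝓝 0) := by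
    have h3 : Tendsto (fun r : ℝ => Real.log (1 + r) / (1 + r) * ((1 + r) / r)) atTop
        (𝓝 (0 * 1)) := by
      refine Tendsto.mul ?_ ?_
      · have h4 := (Real.isLittleO_log_id_atTop).tendsto_div_nhds_zero
        exact h4.comp (tendsto_atTop_add_const_left _ 1 tendsto_id)
      · have h5 : Tendsto (fun r : ℝ => 1 / r + 1) atTop (𝓝 (0 + 1)) :=
          (tendsto_const_nhds.div_atTop tendsto_id).add_const 1
        rw [zero_add] at h5
        refine h5.congr' ?_
        filter_upwards [eventually_gt_atTop 0] with r hr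
        field_simp
    rw [zero_mul] at h3
    refine h3.congr' ?_
    filter_upwards [eventually_gt_atTop 0] with r hr
    field_simp
  have h := h1.add (h2.const_mul K)
  rw [mul_zero, add_zero] at h
  refine h.congr fun r => ?_
  rw [add_div, mul_div_assoc]

/-- On a non-exceptional circle `exists_log_bound` applies with `d = 1 / (1 + r)` at every angle at
once, which makes the limit uniform in `θ`. -/
lemma hasIndicator (hf : ExpBounds f l₀ l₁ X C) :
    HasIndicator f 1 fun θ => max (-l₀ * Real.cos θ) (-l₁ * Real.cos θ) := by
  refine ⟨exceptionalRadii f, hf.hasRelativeDensityZero_exceptionalRadii, fun ε hε => ?_⟩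
  obtain ⟨K, B, hB, h⟩ := hf.exists_log_bound
  have hev := (tendsto_log_error B K).eventually (gt_mem_nhds hε)
  obtain ⟨R, hR⟩ := eventually_atTop.1 hev
  refine ⟨max R 1, by positivity, fun r hr hrE θ => ?_⟩
  have hr0 : 0 < r := lt_of_lt_of_le one_pos ((le_max_right R 1).trans hr.le)
  set z : ℂ := r * Complex.exp (θ * Complex.I) with hz
  have hzn : ‖z‖ = r := by
    rw [hz, norm_mul, Complex.norm_exp_ofReal_mul_I, mul_one, Complex.norm_real,
      Real.norm_of_nonneg hr0.le]
  have hzre : z.re = r * Real.cos θ := by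
    rw [hz, Complex.re_ofReal_mul, Complex.exp_ofReal_mul_I_re]
  have hd : ∀ u, f u = 0 → 1 / (1 + r) ≤ ‖z - u‖ := fun u hu => by
    by_contra! hlt
    refine hrE ?_
    simp only [exceptionalRadii, Set.mem_iUnion, Set.mem_ofPred_eq, exists_prop]
    refine ⟨u, hu, ?_⟩
    rw [abs_of_pos hr0, abs_sub_comm]
    have := abs_norm_sub_norm_le z u
    rw [hzn] at this
    linarith
  obtain ⟨hne, hlog⟩ := h z (1 / (1 + r)) (by positivity)
    (by rw [div_le_one (by positivity)]; linarith) hd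
  refine ⟨hne, ?_⟩
  have hH : domExp l₀ l₁ z.re = r * max (-l₀ * Real.cos θ) (-l₁ * Real.cos θ) := by
    rw [domExp, hzre, mul_max_of_nonneg _ _ hr0.le]
    congr 1 <;> ring
  rw [hH, one_div, Real.log_inv] at hlog
  have hRr := hR r ((le_max_left R 1).trans hr.le)
  rw [Real.rpow_one]
  rw [show Real.log ‖f z‖ / r - max (-l₀ * Real.cos θ) (-l₁ * Real.cos θ)
    = (Real.log ‖f z‖ - r * max (-l₀ * Real.cos θ) (-l₁ * Real.cos θ)) / r by field_simp,
    abs_div, abs_of_pos hr0]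
  refine lt_of_le_of_lt ?_ hRr
  gcongr
  linarith

end ExpBounds

/-! ### Counting zeros by Jensen's formula -/

/-- The number of zeros of `f` in `S`, counted with multiplicity. -/
noncomputable def zerosIn (f : ℂ → ℂ) (S : Set ℂ) : ℕ := ∑ᶠ z ∈ S, analyticOrderNatAt f z

open Classical in
-- A `∑ᶠ` with infinite support is `0` by convention; the finite set `Z` excludes this case.
lemma zerosIn_eq_sum {f : ℂ → ℂ} {S : Set ℂ} {Z : Finset ℂ} (hZ : ∀ u ∈ S, f u = 0 → u ∈ Z) :
    zerosIn f S = ∑ u ∈ Z, if u ∈ S then analyticOrderNatAt f u else 0 := by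
  rw [zerosIn, finsum_mem_def, finsum_eq_sum_of_support_subset (s := Z)]
  · simp [Set.indicator_apply]
  · intro u hu
    have h1 : u ∈ S := Set.mem_of_indicator_ne_zero hu
    have h2 : analyticOrderNatAt f u ≠ 0 := by
      rw [Function.mem_support, Set.indicator_of_mem h1] at hu
      exact hu
    exact hZ u h1 (apply_eq_zero_of_analyticOrderNatAt_ne_zero h2)

lemma zerosIn_mono {f : ℂ → ℂ} {S S' : Set ℂ} (hfin : (S' ∩ {z | f z = 0}).Finite)
    (h : ∀ u ∈ S, f u = 0 → u ∈ S') : zerosIn f S ≤ zerosIn f S' := by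
  classical
  rw [zerosIn_eq_sum (Z := hfin.toFinset) fun u hu h0 => hfin.mem_toFinset.2 ⟨h u hu h0, h0⟩,
    zerosIn_eq_sum (Z := hfin.toFinset) fun u hu h0 => hfin.mem_toFinset.2 ⟨hu, h0⟩]
  refine Finset.sum_le_sum fun u hu => ?_
  have := (hfin.mem_toFinset.1 hu).1
  split_ifs <;> simp

/-- Jensen's formula as a finite sum over a set of points containing the zeros. -/
lemma circleAverage_log_norm_eq_sum {f : ℂ → ℂ} (hf : Differentiable ℂ f) {c : ℂ} (hc : f c ≠ 0)
    {R : ℝ} (hR : 0 < R) {Z : Finset ℂ} (hZ : ∀ u ∈ Metric.closedBall c R, f u = 0 → u ∈ Z) :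
    Real.circleAverage (fun z => Real.log ‖f z‖) c R =
      ∑ u ∈ Z, (analyticOrderNatAt f u : ℝ) * Real.posLog (R * ‖c - u‖⁻¹) +
        Real.log ‖f c‖ := by
  have han : AnalyticOnNhd ℂ f (Metric.closedBall c |R|) := fun z _ => hf.analyticAt z
  rw [han.circleAverage_log_norm hR.ne' hc, abs_of_pos hR]
  rw [abs_of_pos hR] at han
  congr 1
  have hdiv : ∀ u ∈ Metric.closedBall c R,
      ((MeromorphicOn.divisor f (Metric.closedBall c R) u : ℤ) : ℝ) =
        analyticOrderNatAt f u := fun u hu => by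
    rw [MeromorphicOn.AnalyticOnNhd.divisor_apply han hu]
    rw [analyticOrderNatAt]
    cases analyticOrderAt f u using ENat.recTopCoe <;> simp
  rw [finsum_eq_sum_of_support_subset (s := Z)]
  -- In the disc `posLog` agrees with the logarithm at each zero, and outside it vanishes. Thus `Z`
  -- may reach beyond the disc, and one `Z` serves several radii.
  · refine Finset.sum_congr rfl fun u _ => ?_
    by_cases hu : u ∈ Metric.closedBall c R
    · rw [hdiv u hu]
      rcases eq_or_ne u c with rfl | huc
      · have : analyticOrderNatAt f u = 0 := by
          by_contra h
          exact hc (apply_eq_zero_of_analyticOrderNatAt_ne_zero h)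
        simp [this]
      · congr 1
        rw [Real.posLog_eq_log]
        have hpos : 0 < ‖c - u‖ := norm_pos_iff.2 (sub_ne_zero.2 huc.symm)
        rw [Metric.mem_closedBall, dist_comm, dist_eq_norm] at hu
        rw [abs_of_pos (by positivity), ← div_eq_mul_inv, le_div_iff₀ hpos]
        linarith
    · rw [Function.locallyFinsuppWithin.apply_eq_zero_of_notMem _ hu]
      rw [Metric.mem_closedBall, dist_comm, dist_eq_norm, not_le] at hu
      have : Real.posLog (R * ‖c - u‖⁻¹) = 0 := by
        have hpos := hR.trans hu
        rw [Real.posLog_eq_zero_iff, abs_of_pos (by positivity), ← div_eq_mul_inv,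
          div_le_one hpos]
        exact hu.le
      simp [this]
  · intro u hu
    have hmem : u ∈ Metric.closedBall c R := by
      by_contra h
      rw [Function.mem_support, Function.locallyFinsuppWithin.apply_eq_zero_of_notMem _ h] at hu
      simp at hu
    refine hZ u hmem (apply_eq_zero_of_analyticOrderNatAt_ne_zero fun h => ?_)
    rw [Function.mem_support, hdiv u hmem, h] at hu
    simp at hu

lemma integral_abs_cos : ∫ θ in (0 : ℝ)..(2 * Real.pi), |Real.cos θ| = 4 := by
  have hper : Function.Periodic (fun θ : ℝ => |Real.cos θ|) (2 * Real.pi) := fun θ => by simp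
  have h := hper.intervalIntegral_add_eq 0 (-(Real.pi / 2))
  rw [zero_add] at h
  have hpi := Real.pi_pos
  have hcont : Continuous fun θ : ℝ => |Real.cos θ| := by fun_prop
  rw [h, ← intervalIntegral.integral_add_adjacent_intervals (b := Real.pi / 2)
    (hcont.intervalIntegrable _ _) (hcont.intervalIntegrable _ _)]
  have h1 : ∫ θ in (-(Real.pi / 2))..(Real.pi / 2), |Real.cos θ| =
      ∫ θ in (-(Real.pi / 2))..(Real.pi / 2), Real.cos θ := by
    refine intervalIntegral.integral_congr fun θ hθ => ?_
    rw [Set.uIcc_of_le (by linarith)] at hθ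
    exact abs_of_nonneg (Real.cos_nonneg_of_mem_Icc hθ)
  have h2 : ∫ θ in (Real.pi / 2)..(-(Real.pi / 2) + 2 * Real.pi), |Real.cos θ| =
      ∫ θ in (Real.pi / 2)..(-(Real.pi / 2) + 2 * Real.pi), -Real.cos θ := by
    refine intervalIntegral.integral_congr fun θ hθ => ?_
    rw [Set.uIcc_of_le (by linarith)] at hθ
    exact abs_of_nonpos (Real.cos_nonpos_of_pi_div_two_le_of_le hθ.1 (by linarith [hθ.2]))
  rw [h1, h2, intervalIntegral.integral_neg, integral_cos, integral_cos, Real.sin_add_two_pi,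
    Real.sin_neg, Real.sin_pi_div_two]
  norm_num

/-- The linear part has mean zero over a circle centred at the origin, so only the `|x|` part
contributes to the average. -/
lemma domExp_eq {l₀ l₁ : ℝ} (h : l₀ ≤ l₁) (x : ℝ) :
    domExp l₀ l₁ x = (l₁ - l₀) / 2 * |x| - (l₀ + l₁) / 2 * x := by
  unfold domExp
  rcases le_total 0 x with hx | hx
  · rw [abs_of_nonneg hx, max_eq_left (by nlinarith)]; ring
  · rw [abs_of_nonpos hx, max_eq_right (by nlinarith)]; ring

/-- The circle average of a function close to `domExp l₀ l₁ (Re z)`. -/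
lemma abs_circleAverage_sub_le {l₀ l₁ B R : ℝ} (h : l₀ ≤ l₁) {F : ℂ → ℝ} {c : ℂ}
    (hF : CircleIntegrable F c R) (hR : 0 < R)
    (hB : ∀ z ∈ Metric.sphere c R, |F z - domExp l₀ l₁ z.re| ≤ B) :
    |Real.circleAverage F c R - R * ((l₁ - l₀) / Real.pi)| ≤ B + (|l₀| + |l₁|) * |c.re| := by
  -- `G θ` is `domExp` at `R cos θ`, as for a circle centred at `0`; the true centre shifts the real
  -- part by `c.re`, which costs the last term of the bound.
  set G : ℝ → ℝ := fun θ => (l₁ - l₀) / 2 * R * |Real.cos θ| - (l₀ + l₁) / 2 * R * Real.cos θ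
    with hG
  have hGint : ∫ θ in (0 : ℝ)..(2 * Real.pi), G θ = (l₁ - l₀) / 2 * R * 4 := by
    rw [hG, intervalIntegral.integral_sub
      (Continuous.intervalIntegrable (by fun_prop) _ _)
      (Continuous.intervalIntegrable (by fun_prop) _ _),
      intervalIntegral.integral_const_mul, intervalIntegral.integral_const_mul, integral_abs_cos,
      integral_cos]
    simp
  have hGi : IntervalIntegrable G MeasureTheory.volume 0 (2 * Real.pi) :=
    Continuous.intervalIntegrable (by fun_prop) _ _
  have hpt : ∀ θ : ℝ, ‖F (circleMap c R θ) - G θ‖ ≤ B + (|l₀| + |l₁|) * |c.re| := fun θ => by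
    have hmem : circleMap c R θ ∈ Metric.sphere c R := circleMap_mem_sphere c hR.le θ
    have hre : (circleMap c R θ).re = c.re + R * Real.cos θ := by
      rw [circleMap, Complex.add_re, Complex.re_ofReal_mul, Complex.exp_ofReal_mul_I_re]
    have h1 := hB _ hmem
    have h2 := abs_domExp_sub_le l₀ l₁ (circleMap c R θ).re (R * Real.cos θ)
    have h3 : domExp l₀ l₁ (R * Real.cos θ) = G θ := by
      rw [domExp_eq h, abs_mul, abs_of_pos hR]; ring
    rw [h3, show (circleMap c R θ).re - R * Real.cos θ = c.re by rw [hre]; ring] at h2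
    rw [Real.norm_eq_abs]
    exact (abs_sub_le _ _ _).trans (add_le_add h1 h2)
  have hint := intervalIntegral.norm_integral_le_of_norm_le_const
    (a := 0) (b := 2 * Real.pi) (fun θ _ => hpt θ)
  have hFi : IntervalIntegrable (fun θ => F (circleMap c R θ)) MeasureTheory.volume 0
    (2 * Real.pi) := hF
  rw [intervalIntegral.integral_sub hFi hGi, hGint, sub_zero,
    abs_of_pos Real.two_pi_pos, Real.norm_eq_abs] at hint
  rw [Real.circleAverage_def, smul_eq_mul]
  set A := ∫ θ in (0 : ℝ)..(2 * Real.pi), F (circleMap c R θ)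
  have hpi := Real.pi_pos
  rw [show (2 * Real.pi)⁻¹ * A - R * ((l₁ - l₀) / Real.pi)
    = (A - (l₁ - l₀) / 2 * R * 4) / (2 * Real.pi) by field_simp; ring, abs_div,
    abs_of_pos Real.two_pi_pos, div_le_iff₀ Real.two_pi_pos]
  exact hint

/-! ### Zeros in discs, uniformly in the centre -/

namespace ExpBounds

variable {f : ℂ → ℂ} {l₀ l₁ X C : ℝ}

/-- Every unit interval of radii contains one whose circle keeps away from the zeros. -/
lemma exists_good_radius (hf : ExpBounds f l₀ l₁ X C) :
    ∃ η : ℝ, 0 < η ∧ η ≤ 1 ∧ ∀ c : ℂ, |c.re| ≤ X → ∀ R : ℝ, ∃ R' ∈ Set.Icc R (R + 1),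
      ∀ u, f u = 0 → η ≤ |‖u - c‖ - R'| := by
  obtain ⟨K, hK⟩ := hf.exists_card_ring
  have hη : (1 : ℝ) / (2 * (K + 1)) ≤ 1 := by
    rw [div_le_one (by positivity)]
    have : (0 : ℝ) ≤ K := Nat.cast_nonneg K
    linarith
  refine ⟨1 / (2 * (K + 1)), by positivity, hη, fun c hc R => ?_⟩
  -- `K` intervals of length `2 * η` have total length `K / (K + 1) < 1`, so they cannot cover `[R,
  -- R + 1]`.
  set η : ℝ := 1 / (2 * (K + 1)) with hηdef
  obtain ⟨s, hs, hsz⟩ := hK c hc R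
  by_contra! hcon
  have hsub : Set.Icc R (R + 1) ⊆ ⋃ u ∈ s, Metric.ball ‖u - c‖ η := by
    intro r hr
    obtain ⟨u, hu, hur⟩ := hcon r hr
    simp only [Set.mem_iUnion, exists_prop]
    refine ⟨u, hsz u hu ?_, ?_⟩
    · rw [abs_lt] at hur
      rw [abs_le]
      constructor <;> linarith [hr.1, hr.2]
    · rwa [Metric.mem_ball, Real.dist_eq, abs_sub_comm]
  have hvol : ENNReal.ofReal 1 ≤ ENNReal.ofReal (K * (2 * η)) := by
    calc ENNReal.ofReal 1 = MeasureTheory.volume (Set.Icc R (R + 1)) := by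
          rw [Real.volume_Icc]; congr 1; ring
      _ ≤ MeasureTheory.volume (⋃ u ∈ s, Metric.ball ‖u - c‖ η) := MeasureTheory.measure_mono hsub
      _ ≤ ∑ u ∈ s, MeasureTheory.volume (Metric.ball ‖u - c‖ η) :=
          MeasureTheory.measure_biUnion_finset_le _ _
      _ = s.card • ENNReal.ofReal (2 * η) := by simp [Real.volume_ball]
      _ ≤ K • ENNReal.ofReal (2 * η) := by gcongr
      _ = ENNReal.ofReal (K * (2 * η)) := by rw [← ENNReal.ofReal_nsmul, nsmul_eq_mul]
  rw [ENNReal.ofReal_le_ofReal_iff (by positivity)] at hvol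
  have : (K : ℝ) * (2 * η) < 1 := by
    rw [hηdef, show (K : ℝ) * (2 * (1 / (2 * (K + 1)))) = K / (K + 1) by field_simp,
      div_lt_one (by positivity)]
    linarith
  linarith

/-- Jensen's sum grows linearly, uniformly for all discs centred on the line `Re z = X`. -/
lemma exists_jensen_bound (hf : ExpBounds f l₀ l₁ X C) :
    ∃ B : ℝ, 0 ≤ B ∧ ∀ c : ℂ, c.re = X → ∀ R : ℝ, 1 < R → ∀ Z : Finset ℂ,
      (∀ u ∈ Metric.closedBall c (R + 1), f u = 0 → u ∈ Z) →
      |∑ u ∈ Z, (analyticOrderNatAt f u : ℝ) * Real.posLog (R * ‖c - u‖⁻¹) -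
        R * ((l₁ - l₀) / Real.pi)| ≤ B := by
  obtain ⟨η, hη, hη1, hgood⟩ := hf.exists_good_radius
  obtain ⟨K, B, hB, hlog⟩ := hf.exists_log_bound
  have hX := hf.X_pos
  have hC := hf.C_nonneg
  set L := |l₀| + |l₁| with hL
  have hLX : 0 ≤ L * X := by positivity
  set D := (l₁ - l₀) / Real.pi with hD
  have hD0 : 0 ≤ D := div_nonneg (sub_nonneg.2 hf.le) Real.pi_pos.le
  have hKη : K * Real.log η ≤ 0 :=
    mul_nonpos_of_nonneg_of_nonpos (Nat.cast_nonneg K) (Real.log_nonpos hη.le hη1)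
  -- The three errors: `log ‖f z‖` at distance `η` from the zeros, the shift of the centre, and the
  -- term `log ‖f c‖` of Jensen's formula.
  set B₁ := (B - K * Real.log η) + L * X + (L * X + C) with hB₁
  have hB₁0 : 0 ≤ B₁ := by rw [hB₁]; linarith
  refine ⟨B₁ + D, by positivity, fun c hc R hR Z hZ => ?_⟩
  set J : ℝ → ℝ := fun r => ∑ u ∈ Z, (analyticOrderNatAt f u : ℝ) * Real.posLog (r * ‖c - u‖⁻¹)
    with hJ
  have hmono : ∀ r r' : ℝ, 0 ≤ r → r ≤ r' → J r ≤ J r' := fun r r' h0 h => by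
    refine Finset.sum_le_sum fun u _ => mul_le_mul_of_nonneg_left ?_ (Nat.cast_nonneg _)
    exact Real.posLog_le_posLog (by positivity) (by gcongr)
  have hcX : |c.re| = X := by rw [hc, abs_of_pos hX]
  have hfc : f c ≠ 0 := hf.ne_zero hcX.ge
  have hfcn := norm_pos_iff.2 hfc
  have hfclog : |Real.log ‖f c‖| ≤ L * X + C := by
    have h1 := (Real.log_le_iff_le_exp hfcn).2 (hf.upper c)
    have h2 := (Real.le_log_iff_exp_le hfcn).2 (hf.lower c hcX.ge)
    have h3 := abs_le.1 (abs_domExp_le l₀ l₁ c.re)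
    rw [hcX] at h3
    rw [abs_le]
    constructor <;> linarith
  have hgoodJ : ∀ r, 0 < r → r ≤ R + 1 → (∀ u, f u = 0 → η ≤ |‖u - c‖ - r|) →
      |J r - r * D| ≤ B₁ := fun r hr hrR hru => by
    have hjen := circleAverage_log_norm_eq_sum hf.differentiable hfc hr (Z := Z)
      fun u hu => hZ u (Metric.closedBall_subset_closedBall hrR hu)
    have hFint : CircleIntegrable (fun z => Real.log ‖f z‖) c r :=
      MeromorphicOn.circleIntegrable_log_norm fun z _ =>
        (hf.differentiable.analyticAt z).meromorphicAt
    have hpt : ∀ z ∈ Metric.sphere c r, |Real.log ‖f z‖ - domExp l₀ l₁ z.re| ≤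
        B - K * Real.log η := fun z hz => by
      refine (hlog z η hη hη1 fun u hu => ?_).2
      refine (hru u hu).trans ?_
      rw [Metric.mem_sphere, dist_eq_norm] at hz
      rw [← hz, norm_sub_rev z u]
      refine (abs_norm_sub_norm_le _ _).trans ?_
      rw [sub_sub_sub_cancel_right]
    have havg := abs_circleAverage_sub_le hf.le hFint hr hpt
    rw [hcX, hjen] at havg
    change |J r + Real.log ‖f c‖ - r * D| ≤ _ at havg
    rw [abs_le] at havg hfclog ⊢
    constructor <;> linarith [havg.1, havg.2, hfclog.1, hfclog.2]
  -- The sum `J` increases with the radius, so good radii within 1 above and below `R` enclose it,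
  -- at the extra cost `D`.
  obtain ⟨r, hr, hru⟩ := hgood c hcX.le R
  obtain ⟨r', hr', hru'⟩ := hgood c hcX.le (R - 1)
  have h1 := abs_le.1 (hgoodJ r (by linarith [hr.1]) hr.2 hru)
  have h2 := abs_le.1 (hgoodJ r' (by linarith [hr'.1]) (by linarith [hr'.2]) hru')
  have h3 := hmono R r (by linarith) hr.1
  have h4 := hmono r' R (by linarith [hr'.1]) (by linarith [hr'.2])
  have h5 : r * D ≤ R * D + D := by nlinarith [hr.2]
  have h6 : R * D - D ≤ r' * D := by nlinarith [hr'.1]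
  change |J R - R * D| ≤ _
  rw [abs_le]
  constructor <;> linarith [h1.1, h1.2, h2.1, h2.2]

/-- The number of zeros in discs centred on the line `Re z = X`, uniformly in the centre. -/
lemma exists_zerosIn_bound (hf : ExpBounds f l₀ l₁ X C) :
    ∃ B : ℝ, 0 ≤ B ∧ ∀ c : ℂ, c.re = X → ∀ R : ℝ, 2 < R → ∀ τ : ℝ, 0 < τ → τ ≤ 1 →
      |(zerosIn f (Metric.closedBall c R) : ℝ) - R * ((l₁ - l₀) / Real.pi)| ≤
        τ * R * ((l₁ - l₀) / Real.pi) + 4 * B / τ := by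
  classical
  obtain ⟨B, hB, h⟩ := hf.exists_jensen_bound
  refine ⟨B, hB, fun c hc R hR τ hτ hτ1 => ?_⟩
  set D := (l₁ - l₀) / Real.pi with hD
  have hD0 : 0 ≤ D := div_nonneg (sub_nonneg.2 hf.le) Real.pi_pos.le
  have hcX : |c.re| = X := by rw [hc, abs_of_pos hf.X_pos]
  have hfin := hf.finite_zeros_of_isBounded
    (Metric.isBounded_closedBall (x := c) (r := (1 + τ) * R + 1))
  set Z := hfin.toFinset with hZdef
  have hZ : ∀ r ≤ (1 + τ) * R + 1, ∀ u ∈ Metric.closedBall c r, f u = 0 → u ∈ Z :=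
    fun r hr u hu h0 => hfin.mem_toFinset.2 ⟨Metric.closedBall_subset_closedBall hr hu, h0⟩
  have hpos : ∀ u ∈ Z, 0 < ‖c - u‖ := fun u hu => by
    refine norm_pos_iff.2 (sub_ne_zero.2 ?_)
    rintro rfl
    exact hf.ne_zero hcX.ge (hfin.mem_toFinset.1 hu).2
  have hτR : 0 < τ * R := by positivity
  have hn : (zerosIn f (Metric.closedBall c R) : ℝ) =
      ∑ u ∈ Z, (analyticOrderNatAt f u : ℝ) * if ‖c - u‖ ≤ R then 1 else 0 := by
    rw [zerosIn_eq_sum (hZ R (by linarith)), Nat.cast_sum]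
    refine Finset.sum_congr rfl fun u _ => ?_
    rw [Metric.mem_closedBall, dist_comm, dist_eq_norm]
    split_ifs <;> simp
  have hlogpos : 0 < Real.log (1 + τ) := Real.log_pos (by linarith)
  set n : ℝ := (zerosIn f (Metric.closedBall c R) : ℝ) with hndef
  have hn0 : 0 ≤ n := Nat.cast_nonneg _
  have hR' : 1 < R / (1 + τ) := by
    rw [lt_div_iff₀ (by linarith)]; linarith
  have hRR : R / (1 + τ) ≤ R := div_le_self (by linarith) (by linarith)
  have h1 := abs_le.1 (h c hc R (by linarith) Z (hZ _ (by linarith)))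
  have h2 := abs_le.1 (h c hc ((1 + τ) * R) (by linarith) Z (hZ _ le_rfl))
  have h3 := abs_le.1 (h c hc (R / (1 + τ)) hR' Z (hZ _ (by linarith)))
  -- Enlarging the radius by `1 + τ` raises the term of each zero in the disc by exactly `log (1 +
  -- τ)` per multiplicity, and lowers no other term.
  have hup : n * Real.log (1 + τ) +
      ∑ u ∈ Z, (analyticOrderNatAt f u : ℝ) * Real.posLog (R * ‖c - u‖⁻¹) ≤
      ∑ u ∈ Z, (analyticOrderNatAt f u : ℝ) * Real.posLog ((1 + τ) * R * ‖c - u‖⁻¹) := by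
    rw [hn, Finset.sum_mul, ← Finset.sum_add_distrib]
    refine Finset.sum_le_sum fun u hu => ?_
    have hd := hpos u hu
    rw [mul_assoc, ← mul_add]
    refine mul_le_mul_of_nonneg_left ?_ (Nat.cast_nonneg _)
    split_ifs with hu'
    · have h4 : 1 ≤ R * ‖c - u‖⁻¹ := by
        rw [← div_eq_mul_inv, le_div_iff₀ hd]; linarith
      have h5 : R * ‖c - u‖⁻¹ ≤ (1 + τ) * R * ‖c - u‖⁻¹ := by
        gcongr; linarith
      rw [Real.posLog_eq_log (by rw [abs_of_pos (by linarith)]; exact h4),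
        Real.posLog_eq_log (by rw [abs_of_pos (by linarith)]; exact h4.trans h5),
        mul_assoc (1 + τ), Real.log_mul (x := 1 + τ) (by positivity) (by linarith), one_mul]
    · rw [zero_mul, zero_add]
      exact Real.posLog_le_posLog (by positivity) (by gcongr; linarith)
  -- Shrinking it by `1 + τ` lowers those terms by at most `log (1 + τ)`; zeros outside the disc
  -- contribute nothing at radius `R`.
  have hlow : ∑ u ∈ Z, (analyticOrderNatAt f u : ℝ) * Real.posLog (R * ‖c - u‖⁻¹) ≤
      n * Real.log (1 + τ) +
      ∑ u ∈ Z, (analyticOrderNatAt f u : ℝ) * Real.posLog (R / (1 + τ) * ‖c - u‖⁻¹) := by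
    rw [hn, Finset.sum_mul, ← Finset.sum_add_distrib]
    refine Finset.sum_le_sum fun u hu => ?_
    have hd := hpos u hu
    rw [mul_assoc, ← mul_add]
    refine mul_le_mul_of_nonneg_left ?_ (Nat.cast_nonneg _)
    split_ifs with hu'
    · have h4 : 1 ≤ R * ‖c - u‖⁻¹ := by
        rw [← div_eq_mul_inv, le_div_iff₀ hd]; linarith
      have h5 : R * ‖c - u‖⁻¹ = (1 + τ) * (R / (1 + τ) * ‖c - u‖⁻¹) := by
        field_simp
      have h6 : 0 < R / (1 + τ) * ‖c - u‖⁻¹ := by positivity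
      rw [Real.posLog_eq_log (by rw [abs_of_pos (by linarith)]; exact h4), h5,
        Real.log_mul (by positivity) h6.ne', one_mul]
      gcongr
      exact le_max_right _ _
    · rw [zero_mul, zero_add]
      have : Real.posLog (R * ‖c - u‖⁻¹) = 0 := by
        rw [Real.posLog_eq_zero_iff, abs_of_pos (by positivity), ← div_eq_mul_inv,
          div_le_one hd]
        exact (not_le.1 hu').le
      rw [this]
      exact Real.posLog_nonneg
  have hlog1 : τ / (1 + τ) ≤ Real.log (1 + τ) := by
    have := Real.one_sub_inv_le_log_of_pos (by linarith : 0 < 1 + τ)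
    rwa [show 1 - (1 + τ)⁻¹ = τ / (1 + τ) by field_simp; ring] at this
  have hlog2 : Real.log (1 + τ) ≤ τ := by
    have := Real.log_le_sub_one_of_pos (by linarith : 0 < 1 + τ)
    linarith
  have hA : n * (τ / (1 + τ)) ≤ τ * R * D + 2 * B := by
    have := mul_le_mul_of_nonneg_left hlog1 hn0
    linarith [h1.1, h2.2]
  have hA' : n * τ ≤ (1 + τ) * (τ * R * D + 2 * B) := by
    rw [mul_div_assoc', div_le_iff₀ (by linarith)] at hA
    linarith
  have hE : τ * R * D / (1 + τ) - 2 * B ≤ n * τ := by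
    have h7 := mul_le_mul_of_nonneg_left hlog2 hn0
    have h8 : R * D - R / (1 + τ) * D = τ * R * D / (1 + τ) := by field_simp; ring
    linarith [h1.1, h3.2]
  have hE' : τ * R * D * (1 - τ) ≤ τ * R * D / (1 + τ) := by
    rw [le_div_iff₀ (by linarith)]
    have : 0 ≤ τ * R * D := by positivity
    nlinarith [sq_nonneg τ]
  have hBτ : 4 * B / τ * τ = 4 * B := by field_simp
  have hBτ' : B * τ ≤ B := mul_le_of_le_one_right hB hτ1
  rw [abs_le]
  constructor
  · refine le_of_mul_le_mul_right ?_ hτ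
    nlinarith
  · refine le_of_mul_le_mul_right ?_ hτ
    nlinarith

end ExpBounds

/-! ### Density of zeros in sectors -/

lemma norm_lt_of_mem_sector {r α β : ℝ} {z : ℂ} (hz : z ∈ sector r α β) : ‖z‖ < r := by
  obtain ⟨ρ, φ, hρ, hρr, -, -, rfl⟩ := hz
  rwa [norm_mul, Complex.norm_exp_ofReal_mul_I, mul_one, Complex.norm_real,
    Real.norm_of_nonneg hρ.le]

namespace ExpBounds

variable {f : ℂ → ℂ} {l₀ l₁ X C : ℝ}

lemma finite_zeros_sector (hf : ExpBounds f l₀ l₁ X C) (r α β : ℝ) :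
    (sector r α β ∩ {z | f z = 0}).Finite :=
  (hf.finite_zeros r).subset fun z hz =>
    ⟨by simpa using (norm_lt_of_mem_sector hz.1).le, hz.2⟩

/-- The centre may move with `r`, since the bound is uniform in it. First fix `τ` small, then let
the radius absorb `4 * B / τ`. -/
lemma tendsto_zerosIn_div (hf : ExpBounds f l₀ l₁ X C) {c : ℝ → ℂ} (hc : ∀ r, (c r).re = X)
    {R : ℝ → ℝ} (hR : Tendsto R atTop atTop) :
    Tendsto (fun r => (zerosIn f (Metric.closedBall (c r) (R r)) : ℝ) / R r) atTop
      (𝓝 ((l₁ - l₀) / Real.pi)) := by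
  obtain ⟨B, hB, h⟩ := hf.exists_zerosIn_bound
  set D := (l₁ - l₀) / Real.pi with hD
  have hD0 : 0 ≤ D := div_nonneg (sub_nonneg.2 hf.le) Real.pi_pos.le
  rw [Metric.tendsto_nhds]
  intro ε hε
  set τ := min 1 (ε / (2 * (D + 1))) with hτ
  have hτ0 : 0 < τ := by positivity
  have hτD : τ * D < ε / 2 := by
    have h1 : τ ≤ ε / (2 * (D + 1)) := min_le_right _ _
    rw [le_div_iff₀ (by positivity)] at h1
    nlinarith
  filter_upwards [hR.eventually_gt_atTop 2, hR.eventually_gt_atTop (8 * B / (τ * ε))]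
    with r hr2 hrB
  have hR0 : 0 < R r := by linarith
  have hb := h (c r) (hc r) (R r) hr2 τ hτ0 (min_le_left _ _)
  rw [Real.dist_eq, show (zerosIn f (Metric.closedBall (c r) (R r)) : ℝ) / R r - D =
    ((zerosIn f (Metric.closedBall (c r) (R r)) : ℝ) - R r * D) / R r by field_simp,
    abs_div, abs_of_pos hR0, div_lt_iff₀ hR0]
  refine hb.trans_lt ?_
  rw [div_lt_iff₀ (by positivity)] at hrB
  have h2 : 4 * B / τ < ε / 2 * R r := by
    rw [div_lt_iff₀ hτ0]; linarith
  nlinarith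

lemma tendsto_zerosIn_half_div (hf : ExpBounds f l₀ l₁ X C) {c : ℝ → ℂ}
    (hc : ∀ r, (c r).re = X) (b : ℝ) :
    Tendsto (fun r => (zerosIn f (Metric.closedBall (c r) (r / 2 + b)) : ℝ) / r) atTop
      (𝓝 ((l₁ - l₀) / (2 * Real.pi))) := by
  have hR : Tendsto (fun r : ℝ => r / 2 + b) atTop atTop :=
    tendsto_atTop_add_const_right _ _ (tendsto_id.atTop_div_const two_pos)
  have h1 : Tendsto (fun r : ℝ => 1 / 2 + b / r) atTop (𝓝 (1 / 2 + 0)) :=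
    tendsto_const_nhds.add (tendsto_const_nhds.div_atTop tendsto_id)
  have h2 := (hf.tendsto_zerosIn_div hc hR).mul h1
  rw [show (l₁ - l₀) / Real.pi * (1 / 2 + 0) = (l₁ - l₀) / (2 * Real.pi) by ring] at h2
  refine h2.congr' ?_
  filter_upwards [hR.eventually_gt_atTop 0, eventually_gt_atTop 0] with r hr hr0
  rw [show (1 : ℝ) / 2 + b / r = (r / 2 + b) / r by field_simp, div_mul_div_cancel₀ hr.ne']

/-- Here `σ = ±1` selects the half-plane. As far as zeros are concerned, the sector lies between
discs about `X + σ i r / 2` of radii `r / 2 - B` and `r / 2 + 2 * X`. -/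
lemma hasSmallSectorDensity_of_cos_eq_zero (hf : ExpBounds f l₀ l₁ X C) {θ : ℝ}
    (hθ : Real.cos θ = 0) : HasSmallSectorDensity f θ ((l₁ - l₀) / (2 * Real.pi)) := by
  have hX := hf.X_pos
  set σ := Real.sin θ with hσ
  have hσ2 : σ * σ = 1 := by
    have := Real.sin_sq_add_cos_sq θ
    rw [hθ] at this
    nlinarith
  have hσabs : |σ| = 1 := by
    rcases mul_self_eq_one_iff.1 hσ2 with h | h <;> simp [h]
  refine ⟨Real.pi / 2, by positivity, fun δ hδ hδ2 =>
    ⟨fun r => hf.finite_zeros_sector r _ _, ?_⟩⟩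
  have hcosδ : Real.cos δ < 1 := by
    have := Real.cos_lt_cos_of_nonneg_of_le_pi_div_two le_rfl hδ2.le hδ
    rwa [Real.cos_zero] at this
  have hcosδ0 : 0 < Real.cos δ := Real.cos_pos_of_mem_Ioo ⟨by linarith, hδ2⟩
  -- A zero in the inner disc has `σ * u.im ≥ B`. The bound `hBX` keeps its modulus below `r`, and
  -- `hBδ` keeps its angle to the axis below `δ`.
  set B := X / (1 - Real.cos δ) + X with hB
  have hBX : X ≤ B := by
    have : 0 < X / (1 - Real.cos δ) := div_pos hX (by linarith)
    linarith
  have hBδ : X * Real.cos δ < B * (1 - Real.cos δ) := by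
    have : X / (1 - Real.cos δ) * (1 - Real.cos δ) = X := by
      field_simp [(by linarith : (1 - Real.cos δ) ≠ 0)]
    rw [hB, add_mul, this]
    nlinarith
  set c : ℝ → ℂ := fun r => X + ((σ * (r / 2) : ℝ) : ℂ) * Complex.I with hc
  have hcre : ∀ r, (c r).re = X := fun r => by simp [hc]
  have hcim : ∀ r, (c r).im = σ * (r / 2) := fun r => by simp [hc]
  have him : ∀ (u : ℂ) (r : ℝ), |u.im - (c r).im| = |σ * u.im - r / 2| := fun u r => by
    rw [hcim, ← one_mul |u.im - _|, ← hσabs, ← abs_mul, mul_sub, ← mul_assoc σ σ, hσ2, one_mul]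
  refine tendsto_of_tendsto_of_tendsto_of_le_of_le' (hf.tendsto_zerosIn_half_div hcre (-B))
    (hf.tendsto_zerosIn_half_div hcre (2 * X)) ?_ ?_
  · filter_upwards [eventually_gt_atTop 0] with r hr
    gcongr
    refine zerosIn_mono (hf.finite_zeros_sector r _ _) fun u hu h0 => ?_
    have hre := hf.abs_re_lt h0
    rw [Metric.mem_closedBall, dist_eq_norm] at hu
    have h1 : |σ * u.im - r / 2| ≤ r / 2 + -B := by
      rw [← him]
      simpa using (Complex.abs_im_le_norm (u - c r)).trans hu
    rw [abs_le] at h1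
    have hy : 0 < σ * u.im := by linarith
    have habsim : |u.im| = σ * u.im := by
      rw [← abs_of_pos hy, abs_mul, hσabs, one_mul]
    have hnorm : ‖u‖ < X + σ * u.im := by
      have := Complex.norm_le_abs_re_add_abs_im u
      linarith
    have hu0 : 0 < ‖u‖ := by
      have := Complex.abs_im_le_norm u
      linarith
    -- Rotation by `-θ` moves the axis of the sector to the positive real axis, so `w.arg` is the
    -- angle from the axis.
    set w : ℂ := u * Complex.exp (((-θ : ℝ) : ℂ) * Complex.I) with hw
    have hwn : ‖w‖ = ‖u‖ := by
      rw [hw, norm_mul, Complex.norm_exp_ofReal_mul_I, mul_one]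
    have hwre : w.re = σ * u.im := by
      rw [hw, Complex.mul_re, Complex.exp_ofReal_mul_I_re, Complex.exp_ofReal_mul_I_im,
        Real.cos_neg, Real.sin_neg, hθ]
      ring
    have hw0 : w ≠ 0 := norm_pos_iff.1 (by rw [hwn]; exact hu0)
    have harg : |w.arg| < δ := by
      by_contra! hge
      have h2 := Real.cos_le_cos_of_nonneg_of_le_pi hδ.le (Complex.abs_arg_le_pi w) hge
      rw [Real.cos_abs, Complex.cos_arg hw0, hwn, hwre, div_le_iff₀ hu0] at h2
      nlinarith
    rw [abs_lt] at harg
    refine ⟨‖u‖, θ + w.arg, hu0, by linarith, by linarith, by linarith, ?_⟩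
    have h3 := Complex.norm_mul_exp_arg_mul_I w
    rw [hwn] at h3
    rw [Complex.ofReal_add, add_mul, add_comm, Complex.exp_add, ← mul_assoc, h3, hw, mul_assoc,
      ← Complex.exp_add]
    simp
  · filter_upwards [eventually_gt_atTop 0] with r hr
    gcongr
    refine zerosIn_mono (hf.finite_zeros_of_isBounded Metric.isBounded_closedBall)
      fun u hu h0 => ?_
    have hre := hf.abs_re_lt h0
    have hn := norm_lt_of_mem_sector hu
    obtain ⟨ρ, φ, hρ, -, hφ1, hφ2, hu'⟩ := hu
    have hy : σ * u.im = ρ * Real.cos (φ - θ) := by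
      rw [hu', Complex.im_ofReal_mul, Complex.exp_ofReal_mul_I_im, Real.cos_sub, hθ]
      ring
    have hpos : 0 < σ * u.im := by
      rw [hy]
      exact mul_pos hρ (Real.cos_pos_of_mem_Ioo ⟨by linarith, by linarith⟩)
    have hle : σ * u.im ≤ ‖u‖ := by
      refine le_trans ?_ (Complex.abs_im_le_norm u)
      rw [← one_mul |u.im|, ← hσabs, ← abs_mul]
      exact le_abs_self _
    rw [Metric.mem_closedBall, dist_eq_norm]
    refine (Complex.norm_le_abs_re_add_abs_im _).trans ?_
    rw [Complex.sub_re, Complex.sub_im, him, hcre]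
    have h1 : |σ * u.im - r / 2| ≤ r / 2 := by
      rw [abs_le]; constructor <;> linarith
    have h2 : |u.re - X| ≤ 2 * X := by
      rw [abs_lt] at hre
      rw [abs_le]; constructor <;> linarith
    linarith

/-- Near `θ` the cosine stays away from `0`, so `|u| |cos φ| < X` confines the zeros of the sector
to a fixed disc, whatever `r` is. -/
lemma hasSmallSectorDensity_of_cos_ne_zero (hf : ExpBounds f l₀ l₁ X C) {θ : ℝ}
    (hθ : Real.cos θ ≠ 0) : HasSmallSectorDensity f θ 0 := by
  have hX := hf.X_pos
  have hc : 0 < |Real.cos θ| := abs_pos.2 hθ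
  have hev : ∀ᶠ φ in 𝓝 θ, |Real.cos θ| / 2 < |Real.cos φ| :=
    (Real.continuous_cos.abs.tendsto θ).eventually (lt_mem_nhds (half_lt_self hc))
  obtain ⟨δ₀, hδ₀, hδ⟩ := Metric.eventually_nhds_iff.1 hev
  refine ⟨δ₀, hδ₀, fun δ hδ1 hδ2 => ⟨fun r => hf.finite_zeros_sector r _ _, ?_⟩⟩
  set S := Metric.closedBall (0 : ℂ) (X / (|Real.cos θ| / 2)) with hS
  have hlim : Tendsto (fun r : ℝ => (zerosIn f S : ℝ) / r) atTop (𝓝 0) :=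
    tendsto_const_nhds.div_atTop tendsto_id
  refine tendsto_of_tendsto_of_tendsto_of_le_of_le' tendsto_const_nhds hlim ?_ ?_
  · filter_upwards [eventually_gt_atTop 0] with r hr
    positivity
  · filter_upwards [eventually_gt_atTop 0] with r hr
    gcongr
    refine zerosIn_mono (hf.finite_zeros _) fun u hu h0 => ?_
    have hre := hf.abs_re_lt h0
    obtain ⟨ρ, φ, hρ, -, hφ1, hφ2, hu'⟩ := hu
    have hφ : |Real.cos θ| / 2 < |Real.cos φ| := by
      refine hδ ?_
      rw [Real.dist_eq, abs_lt]
      constructor <;> linarith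
    have hure : |u.re| = ρ * |Real.cos φ| := by
      rw [hu', Complex.re_ofReal_mul, Complex.exp_ofReal_mul_I_re, abs_mul, abs_of_pos hρ]
    have hun : ‖u‖ = ρ := by
      rw [hu', norm_mul, Complex.norm_exp_ofReal_mul_I, mul_one, Complex.norm_real,
        Real.norm_of_nonneg hρ.le]
    rw [hS, mem_closedBall_zero_iff, hun, le_div_iff₀ (by positivity)]
    rw [hure] at hre
    nlinarith

lemma hasSmallSectorDensity (hf : ExpBounds f l₀ l₁ X C) (θ : ℝ) :
    ((∃ k : ℤ, θ = Real.pi * (k + 1 / 2)) →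
      HasSmallSectorDensity f θ ((l₁ - l₀) / (2 * Real.pi))) ∧
    ((¬ ∃ k : ℤ, θ = Real.pi * (k + 1 / 2)) → HasSmallSectorDensity f θ 0) := by
  have key : (∃ k : ℤ, θ = Real.pi * (k + 1 / 2)) ↔ Real.cos θ = 0 := by
    rw [Real.cos_eq_zero_iff]
    refine exists_congr fun k => ?_
    rw [show Real.pi * ((k : ℝ) + 1 / 2) = (2 * k + 1) * Real.pi / 2 by ring]
  rw [key]
  exact ⟨hf.hasSmallSectorDensity_of_cos_eq_zero, hf.hasSmallSectorDensity_of_cos_ne_zero⟩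

/-! ### Order and type -/

lemma norm_le (hf : ExpBounds f l₀ l₁ X C) (z : ℂ) :
    ‖f z‖ ≤ Real.exp C * Real.exp ((|l₀| + |l₁|) * ‖z‖) := by
  refine (hf.upper z).trans ?_
  rw [← Real.exp_add, Real.exp_le_exp]
  have h1 := (abs_le.1 (abs_domExp_le l₀ l₁ z.re)).2
  have h2 : (|l₀| + |l₁|) * |z.re| ≤ (|l₀| + |l₁|) * ‖z‖ :=
    mul_le_mul_of_nonneg_left (Complex.abs_re_le_norm z) (by positivity)
  linarith

/-- Exponential growth along one of the real half-axes. -/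
lemma exists_growth (hf : ExpBounds f l₀ l₁ X C) (hne : ¬ (l₀ = 0 ∧ l₁ = 0)) :
    ∃ μ > 0, ∃ σ : ℝ, |σ| = 1 ∧
      ∀ x : ℝ, X ≤ x → Real.exp (μ * x - C) ≤ ‖f ((σ * x : ℝ) : ℂ)‖ := by
  have hX := hf.X_pos
  rcases lt_or_ge l₀ 0 with h0 | h0
  · refine ⟨-l₀, by linarith, 1, abs_one, fun x hx => ?_⟩
    refine le_trans ?_ (hf.lower _ ?_)
    · rw [Complex.ofReal_re, one_mul, Real.exp_le_exp]
      exact sub_le_sub_right (le_max_left _ _) C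
    · rw [Complex.ofReal_re, one_mul]
      exact hx.trans (le_abs_self x)
  · have h1 : 0 < l₁ := by
      refine lt_of_le_of_ne (h0.trans hf.le) fun h => hne ⟨?_, h.symm⟩
      have := hf.le
      linarith
    refine ⟨l₁, h1, -1, by simp, fun x hx => ?_⟩
    refine le_trans ?_ (hf.lower _ ?_)
    · rw [Complex.ofReal_re, Real.exp_le_exp]
      refine sub_le_sub_right (le_trans (le_of_eq ?_) (le_max_right _ _)) C
      ring
    · rw [Complex.ofReal_re, neg_one_mul, abs_neg]
      exact hx.trans (le_abs_self x)

/-- Comparing logarithms along a half-axis; `g x = x ^ ρ` serves the order and `g x = A * x` the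
type. -/
lemma eventually_le_of_isBigO {μ σ : ℝ} (hσ : |σ| = 1)
    (hlow : ∀ x : ℝ, X ≤ x → Real.exp (μ * x - C) ≤ ‖f ((σ * x : ℝ) : ℂ)‖) {g : ℝ → ℝ}
    (hO : f =O[cocompact ℂ] fun z => Real.exp (g ‖z‖)) :
    ∃ B : ℝ, ∀ᶠ x in atTop, μ * x ≤ g x + B := by
  obtain ⟨b, hb⟩ := hO.bound
  have htend : Tendsto (fun x : ℝ => ((σ * x : ℝ) : ℂ)) atTop (cocompact ℂ) := by
    rw [← Metric.cobounded_eq_cocompact, ← tendsto_norm_atTop_iff_cobounded]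
    refine tendsto_abs_atTop_atTop.congr fun x => ?_
    rw [Complex.norm_real, Real.norm_eq_abs, abs_mul, hσ, one_mul]
  refine ⟨C + Real.log (max b 1), ?_⟩
  filter_upwards [htend.eventually hb, eventually_ge_atTop X, eventually_ge_atTop 0]
    with x hx hxX hx0
  have hn : ‖((σ * x : ℝ) : ℂ)‖ = x := by
    rw [Complex.norm_real, Real.norm_eq_abs, abs_mul, hσ, one_mul, abs_of_nonneg hx0]
  rw [hn, Real.norm_of_nonneg (Real.exp_pos _).le] at hx
  have h1 : Real.exp (μ * x - C) ≤ Real.exp (Real.log (max b 1) + g x) := by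
    rw [Real.exp_add, Real.exp_log (by positivity)]
    refine (hlow x hxX).trans (hx.trans ?_)
    gcongr
    exact le_max_left _ _
  rw [Real.exp_le_exp] at h1
  linarith

lemma entireOrder_eq (hf : ExpBounds f l₀ l₁ X C) (hne : ¬ (l₀ = 0 ∧ l₁ = 0)) :
    entireOrder f = 1 := by
  refine le_antisymm ?_ ?_
  · refine ENNReal.le_of_forall_pos_le_add fun ε hε _ => ?_
    refine (iInf₂_le (1 + ε) ?_).trans (by push_cast; rfl)
    have hε' : (0 : ℝ) < ε := hε
    have ht : Tendsto (fun z : ℂ => ‖z‖ ^ (ε : ℝ)) (cocompact ℂ) atTop :=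
      (tendsto_rpow_atTop hε').comp (tendsto_norm_cocompact_atTop (E := ℂ))
    refine Asymptotics.IsBigO.of_bound (Real.exp C) ?_
    filter_upwards [ht.eventually_ge_atTop (|l₀| + |l₁|),
      (tendsto_norm_cocompact_atTop (E := ℂ)).eventually_gt_atTop 0] with z hz hz0
    refine (hf.norm_le z).trans ?_
    rw [Real.norm_of_nonneg (Real.exp_pos _).le]
    gcongr
    push_cast
    rw [Real.rpow_add hz0, Real.rpow_one, mul_comm]
    gcongr
  · refine le_iInf₂ fun ρ hρ => ?_
    by_contra! hlt
    have hρ1 : (ρ : ℝ) < 1 := by exact_mod_cast hlt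
    obtain ⟨μ, hμ, σ, hσ, hlow⟩ := hf.exists_growth hne
    obtain ⟨B, hB⟩ := eventually_le_of_isBigO hσ hlow (g := fun x => x ^ (ρ : ℝ)) hρ
    -- If `ρ < 1`, dividing `μ * x ≤ x ^ ρ + B` by `x` bounds `μ > 0` by a null function.
    have h1 : Tendsto (fun x : ℝ => x ^ (-(1 - (ρ : ℝ))) + B / x) atTop (𝓝 (0 + 0)) :=
      (tendsto_rpow_neg_atTop (by linarith)).add (tendsto_const_nhds.div_atTop tendsto_id)
    rw [add_zero] at h1
    obtain ⟨x, hx, hxμ, hx0⟩ :=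
      (hB.and ((h1.eventually (gt_mem_nhds hμ)).and (eventually_gt_atTop 0))).exists
    have h2 : x ^ (-(1 - (ρ : ℝ))) + B / x = (x ^ (ρ : ℝ) + B) / x := by
      rw [neg_sub, Real.rpow_sub hx0, Real.rpow_one, add_div]
    rw [h2, div_lt_iff₀ hx0] at hxμ
    linarith

lemma entireType_lt_top (hf : ExpBounds f l₀ l₁ X C) : entireType f 1 < ⊤ := by
  refine lt_of_le_of_lt (iInf₂_le ⟨|l₀| + |l₁|, by positivity⟩ ?_) ENNReal.coe_lt_top
  refine Asymptotics.IsBigO.of_bound (Real.exp C) (Eventually.of_forall fun z => ?_)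
  rw [Real.norm_of_nonneg (Real.exp_pos _).le, Real.rpow_one]
  exact hf.norm_le z

lemma entireType_pos (hf : ExpBounds f l₀ l₁ X C) (hne : ¬ (l₀ = 0 ∧ l₁ = 0)) :
    0 < entireType f 1 := by
  obtain ⟨μ, hμ, σ, hσ, hlow⟩ := hf.exists_growth hne
  refine lt_of_lt_of_le (ENNReal.ofReal_pos.2 hμ) (le_iInf₂ fun A hA => ?_)
  simp only [Real.rpow_one] at hA
  obtain ⟨B, hB⟩ := eventually_le_of_isBigO hσ hlow (g := fun x => (A : ℝ) * x) hA
  rw [← ENNReal.ofReal_coe_nnreal]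
  refine ENNReal.ofReal_le_ofReal ?_
  by_contra! hlt
  obtain ⟨x, hx, hxB⟩ := (hB.and (eventually_gt_atTop (B / (μ - A)))).exists
  rw [div_lt_iff₀ (by linarith)] at hxB
  linarith

lemma hasCompletelyRegularGrowth (hf : ExpBounds f l₀ l₁ X C) (hne : ¬ (l₀ = 0 ∧ l₁ = 0)) :
    HasCompletelyRegularGrowth f 1 fun θ => max (-l₀ * Real.cos θ) (-l₁ * Real.cos θ) where
  differentiable := hf.differentiable
  order_pos := one_pos
  order_eq := by rw [hf.entireOrder_eq hne, ENNReal.ofReal_one]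
  type_pos := hf.entireType_pos hne
  type_lt_top := hf.entireType_lt_top
  indicator := hf.hasIndicator

end ExpBounds

/-! ### Exponential sums satisfy the bounds -/

lemma norm_mul_exp_neg_mul (a : ℂ) (l : ℝ) (z : ℂ) :
    ‖a * Complex.exp (-(l : ℂ) * z)‖ = ‖a‖ * Real.exp (-l * z.re) := by
  rw [norm_mul, Complex.norm_exp]
  simp

/-- A term of an exponential sum that dominates all others along a filter bounds the sum below. -/
lemma eventually_le_norm_sum {a : ℕ → ℂ} {lam : ℕ → ℝ} {S : Finset ℕ} {p : ℕ} (hp : p ∈ S)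
    (hap : a p ≠ 0) {l : Filter ℝ}
    (h : ∀ k ∈ S, k ≠ p → a k = 0 ∨ Tendsto (fun x => (lam p - lam k) * x) l atBot) :
    ∀ᶠ x in l, ∀ z : ℂ, z.re = x → ‖a p‖ / 2 * Real.exp (-lam p * x) ≤
      ‖∑ k ∈ S, a k * Complex.exp (-(lam k : ℂ) * z)‖ := by
  -- The other terms, measured in units of `exp (-lam p * x)`, tend to zero, so eventually they use
  -- up at most half of the dominant term.
  have hlim : Tendsto (fun x => ∑ k ∈ S.erase p, ‖a k‖ * Real.exp ((lam p - lam k) * x)) l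
      (𝓝 (∑ k ∈ S.erase p, 0)) := by
    refine tendsto_finsetSum _ fun k hk => ?_
    rw [Finset.mem_erase] at hk
    rcases h k hk.2 hk.1 with h0 | h0
    · simp [h0, tendsto_const_nhds]
    · simpa using (Real.tendsto_exp_atBot.comp h0).const_mul ‖a k‖
  rw [Finset.sum_const_zero] at hlim
  have hpos : 0 < ‖a p‖ / 2 := half_pos (norm_pos_iff.2 hap)
  filter_upwards [hlim.eventually (gt_mem_nhds hpos)] with x hx z hz
  rw [← Finset.add_sum_erase S _ hp]
  have h1 : ‖∑ k ∈ S.erase p, a k * Complex.exp (-(lam k : ℂ) * z)‖ ≤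
      ‖a p‖ / 2 * Real.exp (-lam p * x) := by
    refine (norm_sum_le _ _).trans ?_
    refine le_trans (le_of_eq ?_) (mul_le_mul_of_nonneg_right hx.le (Real.exp_pos _).le)
    rw [Finset.sum_mul]
    refine Finset.sum_congr rfl fun k _ => ?_
    rw [norm_mul_exp_neg_mul, hz, mul_assoc, ← Real.exp_add]
    congr 2
    ring
  have h2 := norm_mul_exp_neg_mul (a p) (lam p) z
  rw [hz] at h2
  have h3 := norm_sub_le_norm_add (a p * Complex.exp (-(lam p : ℂ) * z))
    (∑ k ∈ S.erase p, a k * Complex.exp (-(lam k : ℂ) * z))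
  linarith

/-- To the right the vanishing of earlier coefficients makes `n₀` dominant; to the left it is `n'`.
For `n₀ ≤ k ≤ n'` the exponent `-lam k * x` lies between the extreme ones, which gives the upper
bound everywhere. -/
lemma exists_expBounds_dirichletSection {a : ℕ → ℂ} {lam : ℕ → ℝ} (hlam : StrictMono lam)
    {n₀ n' : ℕ} (h0 : a n₀ ≠ 0) (hfirst : ∀ k < n₀, a k = 0) (h1 : a n' ≠ 0) :
    ∃ X C, ExpBounds (dirichletSection a lam n') (lam n₀) (lam n') X C := by
  have hle : n₀ ≤ n' := not_lt.1 fun h => h1 (hfirst n' h)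
  have hlamle : lam n₀ ≤ lam n' := hlam.monotone hle
  have hright := eventually_le_norm_sum (a := a) (lam := lam) (S := Finset.range (n' + 1))
    (p := n₀) (l := atTop) (Finset.mem_range.2 (by omega)) h0 fun k _ hk => by
      rcases lt_or_gt_of_ne hk with h | h
      · exact Or.inl (hfirst k h)
      · exact Or.inr (tendsto_id.const_mul_atTop_of_neg (sub_neg.2 (hlam h)))
  have hleft := eventually_le_norm_sum (a := a) (lam := lam) (S := Finset.range (n' + 1))
    (p := n') (l := atBot) (Finset.mem_range.2 (by omega)) h1 fun k hkS hk => by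
      have h : k < n' := by
        have := Finset.mem_range.1 hkS
        omega
      exact Or.inr (tendsto_id.const_mul_atBot (sub_pos.2 (hlam h)))
  obtain ⟨x₁, hx₁⟩ := eventually_atTop.1 hright
  obtain ⟨x₂, hx₂⟩ := eventually_atBot.1 hleft
  set A := ∑ k ∈ Finset.range (n' + 1), ‖a k‖ with hA
  have hApos : 0 < A := by
    refine lt_of_lt_of_le (norm_pos_iff.2 h1) ?_
    exact Finset.single_le_sum (f := fun k => ‖a k‖) (fun k _ => norm_nonneg _)
      (Finset.mem_range.2 (by omega))
  set C := |Real.log A| + |Real.log (‖a n₀‖ / 2)| + |Real.log (‖a n'‖ / 2)| with hC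
  have hC0 : 0 ≤ C := by positivity
  have hCA : Real.log A ≤ C := (le_abs_self _).trans (by
    rw [hC]; linarith [abs_nonneg (Real.log (‖a n₀‖ / 2)), abs_nonneg (Real.log (‖a n'‖ / 2))])
  have hp0 : 0 < ‖a n₀‖ / 2 := half_pos (norm_pos_iff.2 h0)
  have hp1 : 0 < ‖a n'‖ / 2 := half_pos (norm_pos_iff.2 h1)
  have hCn₀ : -C ≤ Real.log (‖a n₀‖ / 2) := by
    have := neg_abs_le (Real.log (‖a n₀‖ / 2))
    rw [hC]; linarith [abs_nonneg (Real.log A), abs_nonneg (Real.log (‖a n'‖ / 2))]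
  have hCn' : -C ≤ Real.log (‖a n'‖ / 2) := by
    have := neg_abs_le (Real.log (‖a n'‖ / 2))
    rw [hC]; linarith [abs_nonneg (Real.log A), abs_nonneg (Real.log (‖a n₀‖ / 2))]
  -- With this `X`, `|Re z| ≥ X` forces `Re z ≥ x₁` or `Re z ≤ x₂`, according to the sign of `Re z`.
  refine ⟨max 1 (max x₁ (-x₂)), C, ?_, hlamle, by positivity, hC0, fun z => ?_, fun z hz => ?_⟩
  · unfold dirichletSection
    fun_prop
  · have hbd : ∀ k ∈ Finset.range (n' + 1), ‖a k * Complex.exp (-(lam k : ℂ) * z)‖ ≤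
        ‖a k‖ * Real.exp (domExp (lam n₀) (lam n') z.re) := fun k hk => by
      rw [norm_mul_exp_neg_mul]
      rcases lt_or_ge k n₀ with hlt | hge
      · simp [hfirst k hlt]
      · gcongr
        have e0 : lam n₀ ≤ lam k := hlam.monotone hge
        have e1 : lam k ≤ lam n' := hlam.monotone (by have := Finset.mem_range.1 hk; omega)
        rcases le_total 0 z.re with hz | hz
        · exact le_trans (by nlinarith) (le_max_left _ _)
        · exact le_trans (by nlinarith) (le_max_right _ _)
    calc ‖dirichletSection a lam n' z‖ ≤
          ∑ k ∈ Finset.range (n' + 1), ‖a k‖ * Real.exp (domExp (lam n₀) (lam n') z.re) :=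
        (norm_sum_le _ _).trans (Finset.sum_le_sum hbd)
      _ = Real.exp (domExp (lam n₀) (lam n') z.re) * A := by rw [← Finset.sum_mul, mul_comm]
      _ ≤ Real.exp (domExp (lam n₀) (lam n') z.re) * Real.exp C := by
        gcongr
        exact (Real.log_le_iff_le_exp hApos).1 hCA
      _ = _ := (Real.exp_add _ _).symm
  · have hX1 : (1 : ℝ) ≤ |z.re| := (le_max_left _ _).trans hz
    have hX2 : x₁ ≤ |z.re| := ((le_max_left _ _).trans (le_max_right _ _)).trans hz
    have hX3 : -x₂ ≤ |z.re| := ((le_max_right _ _).trans (le_max_right _ _)).trans hz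
    rcases le_total 0 z.re with hs | hs
    · rw [abs_of_nonneg hs] at hX2
      refine le_trans ?_ (hx₁ z.re hX2 z rfl)
      have hd : domExp (lam n₀) (lam n') z.re = -lam n₀ * z.re :=
        max_eq_left (by nlinarith)
      rw [hd, sub_eq_neg_add, Real.exp_add]
      gcongr
      exact (Real.le_log_iff_exp_le hp0).1 hCn₀
    · rw [abs_of_nonpos hs] at hX3
      refine le_trans ?_ (hx₂ z.re (by linarith) z rfl)
      have hd : domExp (lam n₀) (lam n') z.re = -lam n' * z.re :=
        max_eq_right (by nlinarith)
      rw [hd, sub_eq_neg_add, Real.exp_add]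
      gcongr
      exact (Real.le_log_iff_exp_le hp1).1 hCn'

/-- The frequencies are `log (k + 1)` with `k` from `0`, so the lowest is `log 1 = 0` and the last
is `log (n + 1)`; their difference gives the density. -/
lemma zetaSection_succ_eq (n : ℕ) :
    zetaSection (n + 1) = dirichletSection (fun _ => 1) (fun k => Real.log (k + 1)) n := by
  funext s
  have hIcc : Finset.Icc 1 (n + 1) = Finset.Ico 1 (n + 2) := by
    ext k
    simp only [Finset.mem_Icc, Finset.mem_Ico]
    omega
  rw [zetaSection, dirichletSection, hIcc, Finset.sum_Ico_eq_sum_range]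
  refine Finset.sum_congr (by congr 1) fun k _ => ?_
  have hk : ((1 + k : ℕ) : ℂ) ≠ 0 := Nat.cast_ne_zero.2 (by omega)
  rw [Complex.cpow_def_of_ne_zero hk, ← Complex.natCast_log, one_mul]
  congr 1
  push_cast
  rw [add_comm (1 : ℝ)]
  ring

lemma strictMono_log_add_one : StrictMono fun k : ℕ => Real.log ((k : ℝ) + 1) := by
  intro i j hij
  refine Real.log_lt_log (by positivity) ?_
  have : (i : ℝ) < j := by exact_mod_cast hij
  linarith

end DirichletSections

theorem mainTheorem5 :
    (∀ (a : ℕ → ℂ) (lam : ℕ → ℝ), StrictMono lam →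
      ∀ n₀ : ℕ, a n₀ ≠ 0 → (∀ k < n₀, a k = 0) →
      ∀ n' : ℕ, a n' ≠ 0 →
        -- order one, normal type, completely regular growth, unless the section is constant
        ((n₀ < n' ∨ lam n₀ ≠ 0) →
          DirichletSections.HasCompletelyRegularGrowth
            (DirichletSections.dirichletSection a lam n') 1
            (fun θ => max (-lam n₀ * Real.cos θ) (-lam n' * Real.cos θ))) ∧
        -- the indicator (also of a constant section)
        DirichletSections.HasIndicator (DirichletSections.dirichletSection a lam n') 1
          (fun θ => max (-lam n₀ * Real.cos θ) (-lam n' * Real.cos θ)) ∧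
        (∀ θ ∈ Set.Icc 0 (2 * Real.pi),
          (Real.pi / 2 ≤ θ ∧ θ ≤ 3 * Real.pi / 2 →
            max (-lam n₀ * Real.cos θ) (-lam n' * Real.cos θ) = -lam n' * Real.cos θ) ∧
          (¬ (Real.pi / 2 ≤ θ ∧ θ ≤ 3 * Real.pi / 2) →
            max (-lam n₀ * Real.cos θ) (-lam n' * Real.cos θ) = -lam n₀ * Real.cos θ)) ∧
        -- the linear density of the zeros
        (∀ θ : ℝ,
          ((∃ k : ℤ, θ = Real.pi * (k + 1 / 2)) →
            DirichletSections.HasSmallSectorDensity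
              (DirichletSections.dirichletSection a lam n') θ
              ((lam n' - lam n₀) / (2 * Real.pi))) ∧
          ((¬ ∃ k : ℤ, θ = Real.pi * (k + 1 / 2)) →
            DirichletSections.HasSmallSectorDensity
              (DirichletSections.dirichletSection a lam n') θ 0))) ∧
    -- the sections of the zeta function
    (∀ n : ℕ, 1 ≤ n → ∀ θ : ℝ,
      ((∃ k : ℤ, θ = Real.pi * (k + 1 / 2)) →
        DirichletSections.HasSmallSectorDensity (DirichletSections.zetaSection n) θ
          (Real.log n / (2 * Real.pi))) ∧
      ((¬ ∃ k : ℤ, θ = Real.pi * (k + 1 / 2)) →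
        DirichletSections.HasSmallSectorDensity (DirichletSections.zetaSection n) θ 0)) := by
  refine ⟨fun a lam hlam n₀ h0 hfirst n' h1 => ?_, fun n hn θ => ?_⟩
  · obtain ⟨X, C, hf⟩ :=
      DirichletSections.exists_expBounds_dirichletSection hlam h0 hfirst h1
    refine ⟨fun hne => hf.hasCompletelyRegularGrowth ?_, hf.hasIndicator, fun θ hθ => ⟨?_, ?_⟩,
      hf.hasSmallSectorDensity⟩
    -- Strict monotonicity rules out both extreme exponents being zero unless the section is
    -- constant.
    · rintro ⟨e0, e1⟩
      rcases hne with h | h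
      · have := hlam h
        linarith
      · exact h e0
    · rintro ⟨h2, h3⟩
      have hcos := Real.cos_nonpos_of_pi_div_two_le_of_le h2 (by linarith)
      have := hf.le
      exact max_eq_right (by nlinarith)
    · intro h2
      have hcos : 0 ≤ Real.cos θ := by
        rcases lt_or_ge θ (Real.pi / 2) with h3 | h3
        · exact Real.cos_nonneg_of_neg_pi_div_two_le_of_le
            (by linarith [hθ.1, Real.pi_pos]) h3.le
        · have h4 : 3 * Real.pi / 2 < θ := not_le.1 fun h => h2 ⟨h3, h⟩
          rw [← Real.cos_sub_two_pi]
          exact Real.cos_nonneg_of_neg_pi_div_two_le_of_le (by linarith)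
            (by linarith [hθ.2, Real.pi_pos])
      have := hf.le
      exact max_eq_left (by nlinarith)
  · obtain ⟨m, rfl⟩ : ∃ m, n = m + 1 := ⟨n - 1, by omega⟩
    obtain ⟨X, C, hf⟩ := DirichletSections.exists_expBounds_dirichletSection (n₀ := 0) (n' := m)
      (a := fun _ => 1) DirichletSections.strictMono_log_add_one one_ne_zero (by simp)
      one_ne_zero
    rw [DirichletSections.zetaSection_succ_eq]
    simpa using hf.hasSmallSectorDensity θ
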